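/- Let $n\ge 3$ and $R=\mathbb{Z}[t^{\pm1},q^{\pm1}]$. Let $\mathbf{wB}_n$ be the welded braid group, with generators $\sigma_i,\tau_i$ ($1\le i\le n-1$) and relations: $\sigma_i\sigma_k=\sigma_k\sigma_i$, $\tau_i\tau_k=\tau_k\tau_i$, $\sigma_i\tau_k=\tau_k\sigma_i$ for $|i-k|\ge2$; $\tau_i^2=1$; and, for $1\le i\le n-2$, $\sigma_i\sigma_{i+1}\sigma_i=\sigma_{i+1}\sigma_i\sigma_{i+1}$, $\tau_i\tau_{i+1}\tau_i=\tau_{i+1}\tau_i\tau_{i+1}$, $\tau_i\sigma_{i+1}\sigma_i=\sigma_{i+1}\sigma_i\tau_{i+1}$, $\sigma_i\tau_{i+1}\tau_i=\tau_{i+1}\tau_i\sigma_{i+1}$. Let $\mathrm{id}_1*-:\mathbf{wB}_n\to\mathbf{wB}_{n+1}$ be the homomorphism $\sigma_i\mapsto\sigma_{i+1}$, $\tau_i\mapsto\tau_{i+1}$. For a unit $u\in R^\times$, the Burau representation $Bur_{n,u}:\mathbf{wB}_n\to GL_n(R)$ is given by $$\sigma_i\mapsto \mathrm{Id}_{i-1}\oplus\begin{pmatrix}0&u\\1&1-u\end{pmatrix}\oplus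 \mathrm{Id}_{n-i-1},\qquad \tau_i\mapsto \mathrm{Id}_{i-1}\oplus\begin{pmatrix}0&1\\1&0\end{pmatrix}\oplus \mathrm{Id}_{n-i-1},$$ and $Bur^*_{n,u}$ is its dual, $Bur^*_{n,u}(g)=Bur_{n,u}(g^{-1})^T$. Thus $Bur^*_{n,u}(\sigma_i)$ has the block $\begin{pmatrix}1-u^{-1}&u^{-1}\\1&0\end{pmatrix}$. For a unit $r$ and a representation $\rho$ of $\mathbf{wB}_m$ over $R$, $r\rho$ is the tensor product of $\rho$ with the one-dimensional representation $\sigma_i\mapsto r$, $\tau_i\mapsto1$. Let $\mathbf F_n$ be the free group on $x_1,\dots,x_n$, let $a_n:\mathbf{wB}_n\to\mathrm{Aut}(\mathbf F_n)$ be the Artin homomorphism (where $\sigma_i$ sends $x_i\mapsto x_{i+1}$, $x_{i+1}\mapsto x_{i+1}^{-1}x_ix_{i+1}$ and fixes the other $x_j$; $\tau_i$ exchanges $x_i$ and $x_{i+1}$ and fixes the other $x_j$), and let $\xi_{n,1}:\mathbf F_n\to\mathbf{wB}_{n+1}$ be given by $x_i\mapsto(\tau_{i-1}\cdots\tau_1)^{-1}(\sigma_i\tau_i)(\tau_{i-1}\cdots\tau_1)$.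 For a representation $\rho$ of $\mathbf{wB}_{n+1}$ on an $R$-module $V$, regarded as an $\mathbf F_n$-module through $\rho\circ\xi_{n,1}$, the Long–Moody construction $\mathbf{LM}_1(\rho)$ is the representation of $\mathbf{wB}_n$ on $\mathcal I_{\mathbf F_n}\otimes_{\mathbb{Z}[\mathbf F_n]}V$ (with $\mathcal I_{\mathbf F_n}$ the augmentation ideal of $\mathbb Z[\mathbf F_n]$) given by $\lambda\cdot(a\otimes v)=a_n(\lambda)(a)\otimes\rho(\mathrm{id}_1*\lambda)(v)$. Theorem. There is a short exact sequence of $R$-linear representations of $\mathbf{wB}_n$ $$0\to Bur_{n,qt}\to q^{-1}\mathbf{LM}_1\bigl(q\,Bur^*_{n+1,t^{-1}}\bigr)\to Bur^*_{n,t^{-1}}\otimes_R Bur_{n,q}\to 0 ,$$ where $Bur^*_{m,t^{-1}}$ is the dual Burau representation in which $\sigma_i$ has the block $\begin{pmatrix}1-t&t\\1&0\end{pmatrix}$. Equivalently, in terms of the dual of $Bur_{n+1,t}$ itself, there is a short exact sequence of $R$-linear representations of $\mathbf{wB}_n$ $$0\to Bur_{n,qt^{-1}}\to q^{-1}\mathbf{LM}_1\bigl(q\,Bur^*_{n+1,t}\bigr)\to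 Bur^*_{n,t}\otimes_R Bur_{n,q}\to 0 .$$ -/

import Mathlib

open scoped TensorProduct LaurentPolynomial Matrix

noncomputable section

namespace Welded

/-! ### Welded braid groups

Indices start at `0`: `sigma i`, `tau i` (with `i + 1 < n`) and `x_i` (with `i < n`) are what is
usually written `σ_{i+1}`, `τ_{i+1}` and `x_{i+1}`. -/

/-- The generators `σ_i`, `τ_i` of the welded braid group on `n` strands. -/
inductive Gen (n : ℕ) : Type
  | sigma (i : ℕ) (h : i + 1 < n) : Gen n
  | tau (i : ℕ) (h : i + 1 < n) : Gen n

/-- `σ_i` as a letter of the free group on the generators. -/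
def fs {n : ℕ} (i : ℕ) (h : i + 1 < n) : FreeGroup (Gen n) := FreeGroup.of (Gen.sigma i h)

/-- `τ_i` as a letter of the free group on the generators. -/
def ft {n : ℕ} (i : ℕ) (h : i + 1 < n) : FreeGroup (Gen n) := FreeGroup.of (Gen.tau i h)

/-- The defining relators of the welded braid group; a relation `u = v` is the relator `u * v⁻¹`. -/
inductive Rel (n : ℕ) : FreeGroup (Gen n) → Prop
  | sigma_comm (i k : ℕ) (hi : i + 1 < n) (hk : k + 1 < n) (h : i + 2 ≤ k ∨ k + 2 ≤ i) :
      Rel n (fs i hi * fs k hk * (fs k hk * fs i hi)⁻¹)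
  | sigma_braid (i : ℕ) (hi : i + 1 < n) (hj : i + 1 + 1 < n) :
      Rel n (fs i hi * fs (i + 1) hj * fs i hi * (fs (i + 1) hj * fs i hi * fs (i + 1) hj)⁻¹)
  | tau_comm (i k : ℕ) (hi : i + 1 < n) (hk : k + 1 < n) (h : i + 2 ≤ k ∨ k + 2 ≤ i) :
      Rel n (ft i hi * ft k hk * (ft k hk * ft i hi)⁻¹)
  | tau_braid (i : ℕ) (hi : i + 1 < n) (hj : i + 1 + 1 < n) :
      Rel n (ft i hi * ft (i + 1) hj * ft i hi * (ft (i + 1) hj * ft i hi * ft (i + 1) hj)⁻¹)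
  | tau_sq (i : ℕ) (hi : i + 1 < n) : Rel n (ft i hi ^ 2)
  | mixed_comm (i k : ℕ) (hi : i + 1 < n) (hk : k + 1 < n) (h : i + 2 ≤ k ∨ k + 2 ≤ i) :
      Rel n (fs i hi * ft k hk * (ft k hk * fs i hi)⁻¹)
  | mixed_one (i : ℕ) (hi : i + 1 < n) (hj : i + 1 + 1 < n) :
      Rel n (ft i hi * fs (i + 1) hj * fs i hi * (fs (i + 1) hj * fs i hi * ft (i + 1) hj)⁻¹)
  | mixed_two (i : ℕ) (hi : i + 1 < n) (hj : i + 1 + 1 < n) :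
      Rel n (fs i hi * ft (i + 1) hj * ft i hi * (ft (i + 1) hj * ft i hi * fs (i + 1) hj)⁻¹)

/-- The welded braid group `wB_n`. -/
abbrev WB (n : ℕ) : Type := PresentedGroup {r : FreeGroup (Gen n) | Rel n r}

/-- The generator `σ_i` of `wB_n`. -/
def sigma {n : ℕ} (i : ℕ) (h : i + 1 < n) : WB n := PresentedGroup.of (Gen.sigma i h)

/-- The generator `τ_i` of `wB_n`. -/
def tau {n : ℕ} (i : ℕ) (h : i + 1 < n) : WB n := PresentedGroup.of (Gen.tau i h)

section Relations

variable {n : ℕ}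

theorem sigma_comm {i k : ℕ} (hi : i + 1 < n) (hk : k + 1 < n) (h : i + 2 ≤ k ∨ k + 2 ≤ i) :
    sigma i hi * sigma k hk = sigma k hk * sigma i hi :=
  PresentedGroup.mk_eq_mk_of_mul_inv_mem (Rel.sigma_comm i k hi hk h)

theorem sigma_braid {i : ℕ} (hi : i + 1 < n) (hj : i + 1 + 1 < n) :
    sigma i hi * sigma (i + 1) hj * sigma i hi
      = sigma (i + 1) hj * sigma i hi * sigma (i + 1) hj :=
  PresentedGroup.mk_eq_mk_of_mul_inv_mem (Rel.sigma_braid i hi hj)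

theorem tau_comm {i k : ℕ} (hi : i + 1 < n) (hk : k + 1 < n) (h : i + 2 ≤ k ∨ k + 2 ≤ i) :
    tau i hi * tau k hk = tau k hk * tau i hi :=
  PresentedGroup.mk_eq_mk_of_mul_inv_mem (Rel.tau_comm i k hi hk h)

theorem tau_braid {i : ℕ} (hi : i + 1 < n) (hj : i + 1 + 1 < n) :
    tau i hi * tau (i + 1) hj * tau i hi = tau (i + 1) hj * tau i hi * tau (i + 1) hj :=
  PresentedGroup.mk_eq_mk_of_mul_inv_mem (Rel.tau_braid i hi hj)

theorem tau_sq {i : ℕ} (hi : i + 1 < n) : tau i hi * tau i hi = 1 := by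
  have h := PresentedGroup.one_of_mem (rels := {r : FreeGroup (Gen n) | Rel n r}) (Rel.tau_sq i hi)
  rw [map_pow, pow_two] at h
  exact h

theorem mixed_comm {i k : ℕ} (hi : i + 1 < n) (hk : k + 1 < n) (h : i + 2 ≤ k ∨ k + 2 ≤ i) :
    sigma i hi * tau k hk = tau k hk * sigma i hi :=
  PresentedGroup.mk_eq_mk_of_mul_inv_mem (Rel.mixed_comm i k hi hk h)

theorem mixed_one {i : ℕ} (hi : i + 1 < n) (hj : i + 1 + 1 < n) :
    tau i hi * sigma (i + 1) hj * sigma i hi = sigma (i + 1) hj * sigma i hi * tau (i + 1) hj :=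
  PresentedGroup.mk_eq_mk_of_mul_inv_mem (Rel.mixed_one i hi hj)

theorem mixed_two {i : ℕ} (hi : i + 1 < n) (hj : i + 1 + 1 < n) :
    sigma i hi * tau (i + 1) hj * tau i hi = tau (i + 1) hj * tau i hi * sigma (i + 1) hj :=
  PresentedGroup.mk_eq_mk_of_mul_inv_mem (Rel.mixed_two i hi hj)

end Relations

/-- Values of the generators that satisfy the defining relations. -/
structure Sat {n : ℕ} {G : Type*} [Group G] (s t : (i : ℕ) → i + 1 < n → G) : Prop where
  sigma_comm : ∀ (i k : ℕ) (hi : i + 1 < n) (hk : k + 1 < n), (i + 2 ≤ k ∨ k + 2 ≤ i) →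
      s i hi * s k hk = s k hk * s i hi
  sigma_braid : ∀ (i : ℕ) (hi : i + 1 < n) (hj : i + 1 + 1 < n),
      s i hi * s (i + 1) hj * s i hi = s (i + 1) hj * s i hi * s (i + 1) hj
  tau_comm : ∀ (i k : ℕ) (hi : i + 1 < n) (hk : k + 1 < n), (i + 2 ≤ k ∨ k + 2 ≤ i) →
      t i hi * t k hk = t k hk * t i hi
  tau_braid : ∀ (i : ℕ) (hi : i + 1 < n) (hj : i + 1 + 1 < n),
      t i hi * t (i + 1) hj * t i hi = t (i + 1) hj * t i hi * t (i + 1) hj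
  tau_sq : ∀ (i : ℕ) (hi : i + 1 < n), t i hi * t i hi = 1
  mixed_comm : ∀ (i k : ℕ) (hi : i + 1 < n) (hk : k + 1 < n), (i + 2 ≤ k ∨ k + 2 ≤ i) →
      s i hi * t k hk = t k hk * s i hi
  mixed_one : ∀ (i : ℕ) (hi : i + 1 < n) (hj : i + 1 + 1 < n),
      t i hi * s (i + 1) hj * s i hi = s (i + 1) hj * s i hi * t (i + 1) hj
  mixed_two : ∀ (i : ℕ) (hi : i + 1 < n) (hj : i + 1 + 1 < n),
      s i hi * t (i + 1) hj * t i hi = t (i + 1) hj * t i hi * s (i + 1) hj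

/-- The assignment `σ_i ↦ s i`, `τ_i ↦ t i` on the generators. -/
def genVal {n : ℕ} {G : Type*} (s t : (i : ℕ) → i + 1 < n → G) : Gen n → G
  | Gen.sigma i h => s i h
  | Gen.tau i h => t i h

theorem Sat.rel {n : ℕ} {G : Type*} [Group G] {s t : (i : ℕ) → i + 1 < n → G} (H : Sat s t) :
    ∀ r ∈ {r : FreeGroup (Gen n) | Rel n r}, FreeGroup.lift (genVal s t) r = 1 := by
  intro r hr
  cases hr with
  | tau_sq i hi =>
    rw [map_pow, pow_two, ft, FreeGroup.lift_apply_of]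
    exact H.tau_sq i hi
  | sigma_comm i k hi hk h =>
    simp only [fs, map_mul, map_inv, FreeGroup.lift_apply_of, mul_inv_eq_one]
    exact H.sigma_comm i k hi hk h
  | sigma_braid i hi hj =>
    simp only [fs, map_mul, map_inv, FreeGroup.lift_apply_of, mul_inv_eq_one]
    exact H.sigma_braid i hi hj
  | tau_comm i k hi hk h =>
    simp only [ft, map_mul, map_inv, FreeGroup.lift_apply_of, mul_inv_eq_one]
    exact H.tau_comm i k hi hk h
  | tau_braid i hi hj =>
    simp only [ft, map_mul, map_inv, FreeGroup.lift_apply_of, mul_inv_eq_one]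
    exact H.tau_braid i hi hj
  | mixed_comm i k hi hk h =>
    simp only [fs, ft, map_mul, map_inv, FreeGroup.lift_apply_of, mul_inv_eq_one]
    exact H.mixed_comm i k hi hk h
  | mixed_one i hi hj =>
    simp only [fs, ft, map_mul, map_inv, FreeGroup.lift_apply_of, mul_inv_eq_one]
    exact H.mixed_one i hi hj
  | mixed_two i hi hj =>
    simp only [fs, ft, map_mul, map_inv, FreeGroup.lift_apply_of, mul_inv_eq_one]
    exact H.mixed_two i hi hj

/-- The homomorphism from `wB_n` with `σ_i ↦ s i` and `τ_i ↦ t i`. -/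
def liftWB {n : ℕ} {G : Type*} [Group G] {s t : (i : ℕ) → i + 1 < n → G} (H : Sat s t) :
    WB n →* G := PresentedGroup.toGroup H.rel

@[simp] theorem liftWB_sigma {n : ℕ} {G : Type*} [Group G] {s t : (i : ℕ) → i + 1 < n → G}
    (H : Sat s t) (i : ℕ) (h : i + 1 < n) : liftWB H (sigma i h) = s i h :=
  PresentedGroup.toGroup.of H.rel

@[simp] theorem liftWB_tau {n : ℕ} {G : Type*} [Group G] {s t : (i : ℕ) → i + 1 < n → G}
    (H : Sat s t) (i : ℕ) (h : i + 1 < n) : liftWB H (tau i h) = t i h :=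
  PresentedGroup.toGroup.of H.rel

/-- The homomorphism `id_1 * - : wB_n → wB_{n+1}`, `σ_i ↦ σ_{i+1}`, `τ_i ↦ τ_{i+1}`. -/
def shift (n : ℕ) : WB n →* WB (n + 1) :=
  liftWB (s := fun i h => sigma (i + 1) (Nat.succ_lt_succ h))
    (t := fun i h => tau (i + 1) (Nat.succ_lt_succ h))
    { sigma_comm := fun _ _ _ _ h => sigma_comm _ _ (by omega)
      sigma_braid := fun _ _ _ => sigma_braid _ _
      tau_comm := fun _ _ _ _ h => tau_comm _ _ (by omega)
      tau_braid := fun _ _ _ => tau_braid _ _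
      tau_sq := fun _ _ => tau_sq _
      mixed_comm := fun _ _ _ _ h => mixed_comm _ _ (by omega)
      mixed_one := fun _ _ _ => mixed_one _ _
      mixed_two := fun _ _ _ => mixed_two _ _ }

/-- The one-dimensional representation `σ_i ↦ r`, `τ_i ↦ 1`. -/
def oneDim (n : ℕ) {R : Type*} [CommRing R] (r : Rˣ) : WB n →* Rˣ :=
  liftWB (s := fun _ _ => r) (t := fun _ _ => 1)
    (by constructor <;> intros <;> simp)

/-- The representation `r ρ`, the tensor product of `ρ` with the one-dimensional representation
`r`, on the space of `ρ`. -/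
def twist {n : ℕ} {R V : Type*} [CommRing R] [AddCommGroup V] [Module R V] (r : Rˣ)
    (ρ : Representation R (WB n) V) : Representation R (WB n) V where
  toFun g := (oneDim n r g : R) • ρ g
  map_one' := by simp
  map_mul' g h := by
    ext v
    simp only [map_mul, Units.val_mul, LinearMap.smul_apply, Module.End.mul_apply, map_smul,
      smul_smul]
    rw [mul_comm]

/-! ### The Burau representation and its dual -/

/-- The matrix `Id_i ⊕ M ⊕ Id_{n-i-2}`, where `M = [[a, b], [c, d]]` sits in the rows and columns
`i` and `i + 1`. -/
def block {n : ℕ} {R : Type*} [CommRing R] (i : ℕ) (h : i + 1 < n) (a b c d : R) :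
    Matrix (Fin n) (Fin n) R :=
  Matrix.of fun k =>
    if k = ⟨i, by omega⟩ then Pi.single ⟨i, by omega⟩ a + Pi.single ⟨i + 1, h⟩ b
    else if k = ⟨i + 1, h⟩ then Pi.single ⟨i, by omega⟩ c + Pi.single ⟨i + 1, h⟩ d
    else Pi.single k 1

theorem block_mulVec {n : ℕ} {R : Type*} [CommRing R] (i : ℕ) (h : i + 1 < n) (a b c d : R)
    (v : Fin n → R) (k : Fin n) : (block i h a b c d).mulVec v k =
      if k.1 = i then a * v ⟨i, by omega⟩ + b * v ⟨i + 1, h⟩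
      else if k.1 = i + 1 then c * v ⟨i, by omega⟩ + d * v ⟨i + 1, h⟩
      else v k := by
  have hk : (block i h a b c d).mulVec v k = (block i h a b c d) k ⬝ᵥ v := rfl
  have hb : (block i h a b c d) k =
    if k = ⟨i, by omega⟩ then Pi.single ⟨i, by omega⟩ a + Pi.single ⟨i + 1, h⟩ b
    else if k = ⟨i + 1, h⟩ then Pi.single ⟨i, by omega⟩ c + Pi.single ⟨i + 1, h⟩ d
    else Pi.single k 1 := rfl
  rw [hk, hb]
  simp only [Fin.ext_iff]
  split_ifs <;> simp [add_dotProduct]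

theorem matrix_ext_mulVec {n : ℕ} {R : Type*} [CommRing R] {A B : Matrix (Fin n) (Fin n) R}
    (h : ∀ v k, A.mulVec v k = B.mulVec v k) : A = B :=
  Matrix.mulVec_injective (funext fun v => funext fun k => h v k)

/-- The matrix `Id ⊕ [[0, t], [1, 1 - t]] ⊕ Id`. -/
def burSigma {n : ℕ} {R : Type*} [CommRing R] (t : Rˣ) (i : ℕ) (h : i + 1 < n) :
    Matrix.GeneralLinearGroup (Fin n) R where
  val := block i h 0 (t : R) 1 (1 - t)
  inv := block i h (1 - (↑t⁻¹ : R)) 1 (↑t⁻¹ : R) 0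
  val_inv := by
    have ht : (t : R) * (↑t⁻¹ : R) = 1 := t.mul_inv
    apply matrix_ext_mulVec
    intro v k
    simp only [← Matrix.mulVec_mulVec, block_mulVec, Matrix.one_mulVec]
    grind
  inv_val := by
    have ht : (t : R) * (↑t⁻¹ : R) = 1 := t.mul_inv
    apply matrix_ext_mulVec
    intro v k
    simp only [← Matrix.mulVec_mulVec, block_mulVec, Matrix.one_mulVec]
    grind

/-- The matrix `Id ⊕ [[0, 1], [1, 0]] ⊕ Id`. -/
def burTau (n : ℕ) (R : Type*) [CommRing R] (i : ℕ) (h : i + 1 < n) :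
    Matrix.GeneralLinearGroup (Fin n) R where
  val := block i h 0 1 1 0
  inv := block i h 0 1 1 0
  val_inv := by
    apply matrix_ext_mulVec
    intro v k
    simp only [← Matrix.mulVec_mulVec, block_mulVec, Matrix.one_mulVec]
    grind
  inv_val := by
    apply matrix_ext_mulVec
    intro v k
    simp only [← Matrix.mulVec_mulVec, block_mulVec, Matrix.one_mulVec]
    grind

theorem gl_ext_mulVec {n : ℕ} {R : Type*} [CommRing R] {A B : Matrix.GeneralLinearGroup (Fin n) R}
    (h : ∀ v k, (A : Matrix (Fin n) (Fin n) R).mulVec v k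
      = (B : Matrix (Fin n) (Fin n) R).mulVec v k) : A = B :=
  Units.ext (matrix_ext_mulVec h)

theorem burSigma_mulVec {n : ℕ} {R : Type*} [CommRing R] (t : Rˣ) (i : ℕ) (h : i + 1 < n)
    (v : Fin n → R) (k : Fin n) :
    (burSigma t i h : Matrix (Fin n) (Fin n) R).mulVec v k =
      if k.1 = i then (t : R) * v ⟨i + 1, h⟩
      else if k.1 = i + 1 then v ⟨i, by omega⟩ + (1 - t) * v ⟨i + 1, h⟩
      else v k := by
  simp [burSigma, block_mulVec]

theorem burTau_mulVec {n : ℕ} {R : Type*} [CommRing R] (i : ℕ) (h : i + 1 < n)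
    (v : Fin n → R) (k : Fin n) :
    (burTau n R i h : Matrix (Fin n) (Fin n) R).mulVec v k =
      if k.1 = i then v ⟨i + 1, h⟩ else if k.1 = i + 1 then v ⟨i, by omega⟩ else v k := by
  simp [burTau, block_mulVec]

theorem bur_sat (n : ℕ) {R : Type*} [CommRing R] (t : Rˣ) :
    Sat (n := n) (burSigma t) (burTau n R) := by
  constructor <;> intros <;> apply gl_ext_mulVec <;> intro v k <;>
    simp only [Units.val_mul, Units.val_one, ← Matrix.mulVec_mulVec, burSigma_mulVec, burTau_mulVec,
      Matrix.one_mulVec] <;>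
    grind

/-- The Burau representation `Bur_{n,t} : wB_n → GL_n(R)` with parameter `t`. -/
def burGL (n : ℕ) {R : Type*} [CommRing R] (t : Rˣ) : WB n →* Matrix.GeneralLinearGroup (Fin n) R :=
  liftWB (bur_sat n t)

/-- The dual Burau representation `Bur*_{n,t}`, in matrices: the transpose of the inverse
of the Burau representation. -/
def burDualGL (n : ℕ) {R : Type*} [CommRing R] (t : Rˣ) :
    WB n →* Matrix.GeneralLinearGroup (Fin n) R where
  toFun g :=
    { val := (burGL n t g⁻¹ : Matrix (Fin n) (Fin n) R)ᵀ
      inv := (burGL n t g : Matrix (Fin n) (Fin n) R)ᵀ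
      val_inv := by rw [← Matrix.transpose_mul, ← Units.val_mul, ← map_mul]; simp
      inv_val := by rw [← Matrix.transpose_mul, ← Units.val_mul, ← map_mul]; simp }
  map_one' := by ext1; simp
  map_mul' g h := by ext1; simp

/-- The action on column vectors of a representation in matrices. -/
def matRep {n : ℕ} {G R : Type*} [Group G] [CommRing R]
    (φ : G →* Matrix.GeneralLinearGroup (Fin n) R) : Representation R G (Fin n → R) :=
  ((Matrix.toLinAlgEquiv' : Matrix (Fin n) (Fin n) R ≃ₐ[R] _) : _ →* _).comp
    ((Units.coeHom _).comp φ)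

/-- `Bur_{n,t}` as a representation on `R^n`. -/
def bur (n : ℕ) {R : Type*} [CommRing R] (t : Rˣ) : Representation R (WB n) (Fin n → R) :=
  matRep (burGL n t)

/-- `Bur*_{n,t}` as a representation on `R^n`. -/
def burDual (n : ℕ) {R : Type*} [CommRing R] (t : Rˣ) : Representation R (WB n) (Fin n → R) :=
  matRep (burDualGL n t)

/-! ### The Artin homomorphism -/

/-- The endomorphism `x_i ↦ x_{i+1}`, `x_{i+1} ↦ x_{i+1}⁻¹ x_i x_{i+1}` of the free group. -/
def artinSigmaHom {n : ℕ} (i : ℕ) (h : i + 1 < n) : FreeGroup (Fin n) →* FreeGroup (Fin n) :=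
  FreeGroup.lift fun k =>
    if k.1 = i then FreeGroup.of ⟨i + 1, h⟩
    else if k.1 = i + 1 then
      (FreeGroup.of ⟨i + 1, h⟩)⁻¹ * FreeGroup.of ⟨i, by omega⟩ * FreeGroup.of ⟨i + 1, h⟩
    else FreeGroup.of k

/-- The inverse of `artinSigmaHom`. -/
def artinSigmaInvHom {n : ℕ} (i : ℕ) (h : i + 1 < n) : FreeGroup (Fin n) →* FreeGroup (Fin n) :=
  FreeGroup.lift fun k =>
    if k.1 = i then
      FreeGroup.of ⟨i, by omega⟩ * FreeGroup.of ⟨i + 1, h⟩ * (FreeGroup.of ⟨i, by omega⟩)⁻¹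
    else if k.1 = i + 1 then FreeGroup.of ⟨i, by omega⟩
    else FreeGroup.of k

/-- The endomorphism exchanging `x_i` and `x_{i+1}`. -/
def artinTauHom {n : ℕ} (i : ℕ) (h : i + 1 < n) : FreeGroup (Fin n) →* FreeGroup (Fin n) :=
  FreeGroup.lift fun k =>
    if k.1 = i then FreeGroup.of ⟨i + 1, h⟩
    else if k.1 = i + 1 then FreeGroup.of ⟨i, by omega⟩
    else FreeGroup.of k

/-- The automorphism of the free group attached to `σ_i`. -/
def artinSigma {n : ℕ} (i : ℕ) (h : i + 1 < n) : MulAut (FreeGroup (Fin n)) :=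
  MonoidHom.toMulEquiv (artinSigmaHom i h) (artinSigmaInvHom i h)
    (by ext k; simp only [artinSigmaHom, artinSigmaInvHom, MonoidHom.comp_apply,
          FreeGroup.lift_apply_of, MonoidHom.id_apply]
        split_ifs with h1 h2
        · simp [← h1]
        · have hk : k = ⟨i + 1, h⟩ := Fin.ext h2
          simp [hk, mul_assoc]
        · simp [h1, h2])
    (by ext k; simp only [artinSigmaHom, artinSigmaInvHom, MonoidHom.comp_apply,
          FreeGroup.lift_apply_of, MonoidHom.id_apply]
        split_ifs with h1 h2
        · have hk : k = ⟨i, by omega⟩ := Fin.ext h1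
          simp [hk, mul_assoc]
        · simp [← h2]
        · simp [h1, h2])

/-- The automorphism of the free group attached to `τ_i`. -/
def artinTau {n : ℕ} (i : ℕ) (h : i + 1 < n) : MulAut (FreeGroup (Fin n)) :=
  MonoidHom.toMulEquiv (artinTauHom i h) (artinTauHom i h)
    (by ext k; simp only [artinTauHom, MonoidHom.comp_apply,
          FreeGroup.lift_apply_of, MonoidHom.id_apply]
        split_ifs with h1 h2
        · simp [← h1]
        · simp [← h2]
        · simp [h1, h2])
    (by ext k; simp only [artinTauHom, MonoidHom.comp_apply,
          FreeGroup.lift_apply_of, MonoidHom.id_apply]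
        split_ifs with h1 h2
        · simp [← h1]
        · simp [← h2]
        · simp [h1, h2])

theorem artinSigma_of {n : ℕ} (i : ℕ) (h : i + 1 < n) (k : Fin n) :
    artinSigma i h (FreeGroup.of k) =
      if k.1 = i then FreeGroup.of ⟨i + 1, h⟩
      else if k.1 = i + 1 then
        (FreeGroup.of ⟨i + 1, h⟩)⁻¹ * FreeGroup.of ⟨i, by omega⟩ * FreeGroup.of ⟨i + 1, h⟩
      else FreeGroup.of k :=
  FreeGroup.lift_apply_of

theorem artinTau_of {n : ℕ} (i : ℕ) (h : i + 1 < n) (k : Fin n) :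
    artinTau i h (FreeGroup.of k) =
      if k.1 = i then FreeGroup.of ⟨i + 1, h⟩
      else if k.1 = i + 1 then FreeGroup.of ⟨i, by omega⟩
      else FreeGroup.of k :=
  FreeGroup.lift_apply_of

theorem mulAut_ext {n : ℕ} {φ ψ : MulAut (FreeGroup (Fin n))}
    (h : ∀ k, φ (FreeGroup.of k) = ψ (FreeGroup.of k)) : φ = ψ := by
  have : φ.toMonoidHom = ψ.toMonoidHom := FreeGroup.ext_hom _ _ h
  exact MulEquiv.ext fun x => DFunLike.congr_fun this x

theorem artinSigma_fst {n : ℕ} (i : ℕ) (h : i + 1 < n) (h' : i < n) :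
    artinSigma i h (FreeGroup.of ⟨i, h'⟩) = FreeGroup.of ⟨i + 1, h⟩ := by
  simp [artinSigma_of]

theorem artinSigma_snd {n : ℕ} (i : ℕ) (h : i + 1 < n) (h' : i + 1 < n) :
    artinSigma i h (FreeGroup.of ⟨i + 1, h'⟩) =
      (FreeGroup.of ⟨i + 1, h⟩)⁻¹ * FreeGroup.of ⟨i, by omega⟩ * FreeGroup.of ⟨i + 1, h⟩ := by
  simp [artinSigma_of]

theorem artinSigma_other {n : ℕ} (i : ℕ) (h : i + 1 < n) (k : ℕ) (hk : k < n)
    (h' : k ≠ i ∧ k ≠ i + 1) :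
    artinSigma i h (FreeGroup.of ⟨k, hk⟩) = FreeGroup.of ⟨k, hk⟩ := by
  simp [artinSigma_of, h'.1, h'.2]

theorem artinTau_fst {n : ℕ} (i : ℕ) (h : i + 1 < n) (h' : i < n) :
    artinTau i h (FreeGroup.of ⟨i, h'⟩) = FreeGroup.of ⟨i + 1, h⟩ := by
  simp [artinTau_of]

theorem artinTau_snd {n : ℕ} (i : ℕ) (h : i + 1 < n) (h' : i + 1 < n) :
    artinTau i h (FreeGroup.of ⟨i + 1, h'⟩) = FreeGroup.of ⟨i, by omega⟩ := by
  simp [artinTau_of]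

theorem artinTau_other {n : ℕ} (i : ℕ) (h : i + 1 < n) (k : ℕ) (hk : k < n)
    (h' : k ≠ i ∧ k ≠ i + 1) :
    artinTau i h (FreeGroup.of ⟨k, hk⟩) = FreeGroup.of ⟨k, hk⟩ := by
  simp [artinTau_of, h'.1, h'.2]

theorem artin_braid_cases {n i : ℕ} (hj : i + 1 + 1 < n) {φ ψ : MulAut (FreeGroup (Fin n))}
    (h0 : φ (FreeGroup.of ⟨i, by omega⟩) = ψ (FreeGroup.of ⟨i, by omega⟩))
    (h1 : φ (FreeGroup.of ⟨i + 1, by omega⟩) = ψ (FreeGroup.of ⟨i + 1, by omega⟩))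
    (h2 : φ (FreeGroup.of ⟨i + 1 + 1, hj⟩) = ψ (FreeGroup.of ⟨i + 1 + 1, hj⟩))
    (h3 : ∀ (k : ℕ) (hk : k < n), k ≠ i → k ≠ i + 1 → k ≠ i + 1 + 1 →
      φ (FreeGroup.of ⟨k, hk⟩) = ψ (FreeGroup.of ⟨k, hk⟩)) : φ = ψ := by
  apply mulAut_ext
  rintro ⟨k, hk⟩
  by_cases e0 : k = i
  · subst e0; exact h0
  by_cases e1 : k = i + 1
  · subst e1; exact h1
  by_cases e2 : k = i + 1 + 1
  · subst e2; exact h2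
  exact h3 k hk e0 e1 e2

theorem artin_comm_cases {n i j : ℕ} (hi : i + 1 < n) (hj : j + 1 < n)
    {φ ψ : MulAut (FreeGroup (Fin n))}
    (h0 : φ (FreeGroup.of ⟨i, by omega⟩) = ψ (FreeGroup.of ⟨i, by omega⟩))
    (h1 : φ (FreeGroup.of ⟨i + 1, hi⟩) = ψ (FreeGroup.of ⟨i + 1, hi⟩))
    (h2 : φ (FreeGroup.of ⟨j, by omega⟩) = ψ (FreeGroup.of ⟨j, by omega⟩))
    (h3 : φ (FreeGroup.of ⟨j + 1, hj⟩) = ψ (FreeGroup.of ⟨j + 1, hj⟩))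
    (h4 : ∀ (k : ℕ) (hk : k < n), k ≠ i → k ≠ i + 1 → k ≠ j → k ≠ j + 1 →
      φ (FreeGroup.of ⟨k, hk⟩) = ψ (FreeGroup.of ⟨k, hk⟩)) : φ = ψ := by
  apply mulAut_ext
  rintro ⟨k, hk⟩
  by_cases e0 : k = i
  · subst e0; exact h0
  by_cases e1 : k = i + 1
  · subst e1; exact h1
  by_cases e2 : k = j
  · subst e2; exact h2
  by_cases e3 : k = j + 1
  · subst e3; exact h3
  exact h4 k hk e0 e1 e2 e3

theorem artin_sat (n : ℕ) :
    Sat (n := n) (G := MulAut (FreeGroup (Fin n))) artinSigma artinTau where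
  sigma_comm i j hi hj h := by
    apply artin_comm_cases hi hj <;> intros <;>
      simp (disch := omega) only [MulAut.mul_apply, map_mul, map_inv, artinSigma_fst,
        artinSigma_snd, artinSigma_other]
  tau_comm i j hi hj h := by
    apply artin_comm_cases hi hj <;> intros <;>
      simp (disch := omega) only [MulAut.mul_apply, artinTau_fst, artinTau_snd, artinTau_other]
  mixed_comm i j hi hj h := by
    apply artin_comm_cases hi hj <;> intros <;>
      simp (disch := omega) only [MulAut.mul_apply, map_mul, map_inv, artinSigma_fst,
        artinSigma_snd, artinSigma_other, artinTau_fst, artinTau_snd, artinTau_other]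
  tau_sq i hi := by
    apply artin_comm_cases hi hi <;> intros <;>
      simp (disch := omega) only [MulAut.mul_apply, MulAut.one_apply, artinTau_fst, artinTau_snd,
        artinTau_other]
  sigma_braid i hi hj := by
    apply artin_braid_cases hj <;> intros <;>
      simp (disch := omega) only [MulAut.mul_apply, map_mul, map_inv, artinSigma_fst,
        artinSigma_snd, artinSigma_other]
    group
  tau_braid i hi hj := by
    apply artin_braid_cases hj <;> intros <;>
      simp (disch := omega) only [MulAut.mul_apply, artinTau_fst, artinTau_snd, artinTau_other]
  mixed_one i hi hj := by
    apply artin_braid_cases hj <;> intros <;>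
      simp (disch := omega) only [MulAut.mul_apply, map_mul, map_inv, artinSigma_fst,
        artinSigma_snd, artinSigma_other, artinTau_fst, artinTau_snd, artinTau_other]
  mixed_two i hi hj := by
    apply artin_braid_cases hj <;> intros <;>
      simp (disch := omega) only [MulAut.mul_apply, map_mul, map_inv, artinSigma_fst,
        artinSigma_snd, artinSigma_other, artinTau_fst, artinTau_snd, artinTau_other]

/-- The Artin homomorphism `wB_n → Aut(F_n)`. -/
def artin (n : ℕ) : WB n →* MulAut (FreeGroup (Fin n)) := liftWB (artin_sat n)

/-! ### The homomorphism `ξ : F_n → wB_{n+1}` -/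

/-- The product `τ_{k-1} ⋯ τ_1 τ_0` in `wB_n`. -/
def tauChain (n : ℕ) : (k : ℕ) → k < n → WB n
  | 0, _ => 1
  | k + 1, h => tau k h * tauChain n k (Nat.lt_of_succ_lt h)

/-- The element `(τ_{k-1} ⋯ τ_0)⁻¹ (σ_k τ_k) (τ_{k-1} ⋯ τ_0)`. -/
def xiVal (n k : ℕ) (h : k + 1 < n) : WB n :=
  (tauChain n k (Nat.lt_of_succ_lt h))⁻¹ * (sigma k h * tau k h)
    * tauChain n k (Nat.lt_of_succ_lt h)

/-- The homomorphism `ξ_{n,1} : F_n → wB_{n+1}`. -/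
def xi (n : ℕ) : FreeGroup (Fin n) →* WB (n + 1) :=
  FreeGroup.lift fun k => xiVal (n + 1) k.1 (Nat.succ_lt_succ k.2)

theorem commute_sigma_chain {n : ℕ} (k : ℕ) (hk : k < n) (j : ℕ) (hj : j + 1 < n) (h : k < j) :
    Commute (sigma j hj) (tauChain n k hk) := by
  induction k with
  | zero => exact Commute.one_right _
  | succ k ih =>
    exact Commute.mul_right (mixed_comm hj hk (by omega)) (ih _ (by omega))

theorem commute_tau_chain {n : ℕ} (k : ℕ) (hk : k < n) (j : ℕ) (hj : j + 1 < n) (h : k < j) :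
    Commute (tau j hj) (tauChain n k hk) := by
  induction k with
  | zero => exact Commute.one_right _
  | succ k ih =>
    exact Commute.mul_right (tau_comm hj hk (by omega)) (ih _ (by omega))

theorem chain_mul_sigma {n : ℕ} (i k : ℕ) (hk : k < n) (hik : i + 2 ≤ k) :
    tauChain n k hk * sigma (i + 1) (by omega) = sigma i (by omega) * tauChain n k hk := by
  induction k, hik using Nat.le_induction with
  | base =>
    have hc := commute_sigma_chain (n := n) i (by omega) (i + 1) (by omega) (Nat.lt_succ_self i)
    simp only [tauChain]
    rw [mul_assoc, mul_assoc, ← hc.eq, ← mul_assoc, ← mul_assoc, ← mixed_two (Nat.lt_of_succ_lt hk) hk]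
    simp only [mul_assoc]
  | succ k hk' ih =>
    simp only [tauChain]
    rw [mul_assoc, ih, ← mul_assoc, ← mixed_comm (i := i) (by omega) hk (by omega), mul_assoc]

theorem chain_mul_tau {n : ℕ} (i k : ℕ) (hk : k < n) (hik : i + 2 ≤ k) :
    tauChain n k hk * tau (i + 1) (by omega) = tau i (by omega) * tauChain n k hk := by
  induction k, hik using Nat.le_induction with
  | base =>
    have hc := commute_tau_chain (n := n) i (by omega) (i + 1) (by omega) (Nat.lt_succ_self i)
    simp only [tauChain]
    rw [mul_assoc, mul_assoc, ← hc.eq, ← mul_assoc, ← mul_assoc, ← tau_braid (Nat.lt_of_succ_lt hk) hk]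
    simp only [mul_assoc]
  | succ k hk' ih =>
    simp only [tauChain]
    rw [mul_assoc, ih, ← mul_assoc, ← tau_comm (i := i) (by omega) hk (by omega), mul_assoc]

theorem conj_commute {G : Type*} [Group G] {s u c a : G} (hc : c * s = u * c) (h : u * a = a * u) :
    Commute s (c⁻¹ * a * c) := by
  have hs : s = c⁻¹ * u * c := by rw [mul_assoc, ← hc]; group
  rw [commute_iff_eq, hs]
  calc c⁻¹ * u * c * (c⁻¹ * a * c) = c⁻¹ * (u * a) * c := by group
    _ = c⁻¹ * a * c * (c⁻¹ * u * c) := by rw [h]; group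

theorem conj_eq {G : Type*} [Group G] {s c a b : G} (hc : Commute s c) (h : s * a = b * s) :
    s * (c⁻¹ * a * c) = c⁻¹ * b * c * s := by
  calc s * (c⁻¹ * a * c) = (s * c⁻¹) * a * c := by group
    _ = c⁻¹ * (s * a) * c := by rw [hc.inv_right.eq]; group
    _ = c⁻¹ * b * (s * c) := by rw [h]; group
    _ = c⁻¹ * b * c * s := by rw [hc.eq]; group

section Core

variable {G : Type*} [Group G] {s0 s1 t0 t1 : G}

theorem core_sigma (h0 : t0 * t0 = 1) (h1 : t1 * t1 = 1) (m1 : t0 * s1 * s0 = s1 * s0 * t1)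
    (m2 : s0 * t1 * t0 = t1 * t0 * s1) : s1 * (s0 * t0) = t0⁻¹ * (s1 * t1) * t0 * s1 := by
  rw [inv_eq_of_mul_eq_one_right h0]
  calc s1 * (s0 * t0) = s1 * s0 * (t1 * t1) * t0 := by rw [h1]; group
    _ = (s1 * s0 * t1) * t1 * t0 := by group
    _ = t0 * s1 * (s0 * t1 * t0) := by rw [← m1]; group
    _ = t0 * (s1 * t1) * t0 * s1 := by rw [m2]; group

theorem core_tau (h0 : t0 * t0 = 1) (h1 : t1 * t1 = 1) (b : t0 * t1 * t0 = t1 * t0 * t1)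
    (m2 : s0 * t1 * t0 = t1 * t0 * s1) : t1 * (s0 * t0) = t0⁻¹ * (s1 * t1) * t0 * t1 := by
  rw [inv_eq_of_mul_eq_one_right h0]
  calc t1 * (s0 * t0) = t1 * (s0 * (t1 * (t0 * t0) * t1)) * t0 := by rw [h0, mul_one, h1]; group
    _ = t1 * (s0 * t1 * t0) * t0 * t1 * t0 := by group
    _ = (t1 * t1) * t0 * s1 * (t0 * t1 * t0) := by rw [m2]; group
    _ = t0 * (s1 * t1) * t0 * t1 := by rw [h1, b]; group

theorem core_snd (h0 : t0 * t0 = 1) (h1 : t1 * t1 = 1) (m1 : t0 * s1 * s0 = s1 * s0 * t1)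
    (m2 : s0 * t1 * t0 = t1 * t0 * s1) (b : s0 * s1 * s0 = s1 * s0 * s1) :
    s1 * (t0⁻¹ * (s1 * t1) * t0)
      = (t0⁻¹ * (s1 * t1) * t0)⁻¹ * (s0 * t0) * (t0⁻¹ * (s1 * t1) * t0) * s1 := by
  have c := core_sigma h0 h1 m1 m2
  have e : t0⁻¹ * (s1 * t1) * t0 * s1 * (t0⁻¹ * (s1 * t1) * t0)
      = s0 * t0 * (t0⁻¹ * (s1 * t1) * t0) * s1 := by
    calc t0⁻¹ * (s1 * t1) * t0 * s1 * (t0⁻¹ * (s1 * t1) * t0)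
        = s1 * s0 * s1 * t1 * t0 := by rw [← c]; group
      _ = s0 * s1 * (s0 * t1 * t0) := by rw [← b]; group
      _ = s0 * t0 * (t0⁻¹ * (s1 * t1) * t0) * s1 := by rw [m2]; group
  generalize t0⁻¹ * (s1 * t1) * t0 = B at e
  calc s1 * B = B⁻¹ * (B * s1 * B) := by group
    _ = B⁻¹ * (s0 * t0) * B * s1 := by rw [e]; group

end Core

theorem commute_sigma_xi {n : ℕ} (k : ℕ) (hk : k + 1 < n) (j : ℕ) (hj : j + 1 + 1 < n)
    (h : k < j ∨ j + 1 < k) : Commute (sigma (j + 1) hj) (xiVal n k hk) := by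
  rcases h with h | h
  · have hc := commute_sigma_chain k (Nat.lt_of_succ_lt hk) (j + 1) hj (by omega)
    have h1 : Commute (sigma (j + 1) hj) (sigma k hk) := sigma_comm hj hk (by omega)
    have h2 : Commute (sigma (j + 1) hj) (tau k hk) := mixed_comm hj hk (by omega)
    exact (hc.inv_right.mul_right (h1.mul_right h2)).mul_right hc
  · have hc := chain_mul_sigma j k (Nat.lt_of_succ_lt hk) (by omega)
    have h1 : Commute (sigma j (by omega)) (sigma k hk) := sigma_comm (by omega) hk (by omega)
    have h2 : Commute (sigma j (by omega)) (tau k hk) := mixed_comm (by omega) hk (by omega)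
    have h3 := (h1.mul_right h2).eq
    exact conj_commute hc h3

theorem commute_tau_xi {n : ℕ} (k : ℕ) (hk : k + 1 < n) (j : ℕ) (hj : j + 1 + 1 < n)
    (h : k < j ∨ j + 1 < k) : Commute (tau (j + 1) hj) (xiVal n k hk) := by
  rcases h with h | h
  · have hc := commute_tau_chain k (Nat.lt_of_succ_lt hk) (j + 1) hj (by omega)
    have h1 : Commute (tau (j + 1) hj) (sigma k hk) := (mixed_comm hk hj (by omega)).symm
    have h2 : Commute (tau (j + 1) hj) (tau k hk) := tau_comm hj hk (by omega)
    exact (hc.inv_right.mul_right (h1.mul_right h2)).mul_right hc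
  · have hc := chain_mul_tau j k (Nat.lt_of_succ_lt hk) (by omega)
    have h1 : Commute (tau j (by omega)) (sigma k hk) := (mixed_comm hk (by omega) (by omega)).symm
    have h2 : Commute (tau j (by omega)) (tau k hk) := tau_comm (by omega) hk (by omega)
    have h3 := (h1.mul_right h2).eq
    exact conj_commute hc h3

theorem xi_step {n : ℕ} (i : ℕ) (hi : i + 1 < n) (hj : i + 1 + 1 < n) :
    xiVal n (i + 1) hj = (tauChain n i (Nat.lt_of_succ_lt hi))⁻¹
      * ((tau i hi)⁻¹ * (sigma (i + 1) hj * tau (i + 1) hj) * tau i hi)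
      * tauChain n i (Nat.lt_of_succ_lt hi) := by
  simp only [xiVal, tauChain, mul_inv_rev, mul_assoc]

theorem sigma_mul_xi {n : ℕ} (i : ℕ) (hi : i + 1 < n) (hj : i + 1 + 1 < n) :
    sigma (i + 1) hj * xiVal n i hi = xiVal n (i + 1) hj * sigma (i + 1) hj := by
  have hc := commute_sigma_chain i (Nat.lt_of_succ_lt hi) (i + 1) hj (Nat.lt_succ_self i)
  rw [xi_step i hi hj, xiVal]
  exact conj_eq hc (core_sigma (tau_sq hi) (tau_sq hj) (mixed_one hi hj) (mixed_two hi hj))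

theorem tau_mul_xi {n : ℕ} (i : ℕ) (hi : i + 1 < n) (hj : i + 1 + 1 < n) :
    tau (i + 1) hj * xiVal n i hi = xiVal n (i + 1) hj * tau (i + 1) hj := by
  have hc := commute_tau_chain i (Nat.lt_of_succ_lt hi) (i + 1) hj (Nat.lt_succ_self i)
  rw [xi_step i hi hj, xiVal]
  exact conj_eq hc (core_tau (tau_sq hi) (tau_sq hj) (tau_braid hi hj) (mixed_two hi hj))

theorem sigma_mul_xi_succ {n : ℕ} (i : ℕ) (hi : i + 1 < n) (hj : i + 1 + 1 < n) :
    sigma (i + 1) hj * xiVal n (i + 1) hj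
      = (xiVal n (i + 1) hj)⁻¹ * xiVal n i hi * xiVal n (i + 1) hj * sigma (i + 1) hj := by
  have hc := commute_sigma_chain i (Nat.lt_of_succ_lt hi) (i + 1) hj (Nat.lt_succ_self i)
  rw [xi_step i hi hj, xiVal]
  have := conj_eq hc (core_snd (tau_sq hi) (tau_sq hj) (mixed_one hi hj) (mixed_two hi hj)
    (sigma_braid hi hj))
  rw [this]
  group

theorem tau_mul_xi_succ {n : ℕ} (i : ℕ) (hi : i + 1 < n) (hj : i + 1 + 1 < n) :
    tau (i + 1) hj * xiVal n (i + 1) hj = xiVal n i hi * tau (i + 1) hj := by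
  have h := tau_mul_xi i hi hj
  have h2 := tau_sq hj
  rw [← eq_mul_inv_iff_mul_eq] at h
  calc _ = tau (i + 1) hj * (xiVal n (i + 1) hj * tau (i + 1) hj) * tau (i + 1) hj := by
        simp only [mul_assoc, h2, mul_one]
    _ = (tau (i + 1) hj * tau (i + 1) hj) * xiVal n i hi * tau (i + 1) hj := by
        rw [← tau_mul_xi i hi hj]; simp only [mul_assoc]
    _ = _ := by rw [h2, one_mul]

theorem xi_of {n : ℕ} (k : ℕ) (hk : k < n) :
    xi n (FreeGroup.of ⟨k, hk⟩) = xiVal (n + 1) k (Nat.succ_lt_succ hk) :=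
  FreeGroup.lift_apply_of

theorem shift_sigma {n : ℕ} (i : ℕ) (h : i + 1 < n) :
    shift n (sigma i h) = sigma (i + 1) (Nat.succ_lt_succ h) := liftWB_sigma _ i h

theorem shift_tau {n : ℕ} (i : ℕ) (h : i + 1 < n) :
    shift n (tau i h) = tau (i + 1) (Nat.succ_lt_succ h) := liftWB_tau _ i h

theorem artin_sigma {n : ℕ} (i : ℕ) (h : i + 1 < n) :
    artin n (sigma i h) = artinSigma i h := liftWB_sigma _ i h

theorem artin_tau {n : ℕ} (i : ℕ) (h : i + 1 < n) :
    artin n (tau i h) = artinTau i h := liftWB_tau _ i h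

theorem xi_sigma {n : ℕ} (i : ℕ) (h : i + 1 < n) (k : Fin n) :
    shift n (sigma i h) * xi n (FreeGroup.of k)
      = xi n (artin n (sigma i h) (FreeGroup.of k)) * shift n (sigma i h) := by
  obtain ⟨k, hk⟩ := k
  rw [shift_sigma, artin_sigma]
  by_cases e0 : k = i
  · subst e0
    rw [artinSigma_fst, xi_of, xi_of]
    exact sigma_mul_xi k _ _
  by_cases e1 : k = i + 1
  · subst e1
    rw [artinSigma_snd]
    simp only [map_mul, map_inv, xi_of]
    exact sigma_mul_xi_succ i _ _
  rw [artinSigma_other i h k hk ⟨e0, e1⟩, xi_of]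
  exact commute_sigma_xi k _ i _ (by omega)

theorem xi_tau {n : ℕ} (i : ℕ) (h : i + 1 < n) (k : Fin n) :
    shift n (tau i h) * xi n (FreeGroup.of k)
      = xi n (artin n (tau i h) (FreeGroup.of k)) * shift n (tau i h) := by
  obtain ⟨k, hk⟩ := k
  rw [shift_tau, artin_tau]
  by_cases e0 : k = i
  · subst e0
    rw [artinTau_fst, xi_of, xi_of]
    exact tau_mul_xi k _ _
  by_cases e1 : k = i + 1
  · subst e1
    rw [artinTau_snd, xi_of, xi_of]
    exact tau_mul_xi_succ i _ _
  rw [artinTau_other i h k hk ⟨e0, e1⟩, xi_of]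
  exact commute_tau_xi k _ i _ (by omega)

theorem xi_gen {n : ℕ} (g : WB n)
    (h : ∀ k, shift n g * xi n (FreeGroup.of k)
      = xi n (artin n g (FreeGroup.of k)) * shift n g) (x : FreeGroup (Fin n)) :
    shift n g * xi n x = xi n (artin n g x) * shift n g := by
  have key : (MulAut.conj (shift n g)).toMonoidHom.comp (xi n)
      = (xi n).comp (artin n g).toMonoidHom := by
    apply FreeGroup.ext_hom
    intro k
    exact mul_inv_eq_of_eq_mul (h k)
  have hx : shift n g * xi n x * (shift n g)⁻¹ = xi n (artin n g x) := DFunLike.congr_fun key x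
  rw [← hx, inv_mul_cancel_right]

/-- The compatibility of `ξ` with the Artin homomorphism. -/
theorem xi_compat {n : ℕ} (g : WB n) (x : FreeGroup (Fin n)) :
    shift n g * xi n x = xi n (artin n g x) * shift n g := by
  have hg : g ∈ Subgroup.closure
      (Set.range (PresentedGroup.of (rels := {r : FreeGroup (Gen n) | Rel n r}))) := by
    rw [PresentedGroup.closure_range_of]; trivial
  induction hg using Subgroup.closure_induction generalizing x with
  | mem g hg =>
    obtain ⟨a, rfl⟩ := hg
    cases a with
    | sigma i h => exact xi_gen (sigma i h) (xi_sigma i h) x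
    | tau i h => exact xi_gen (tau i h) (xi_tau i h) x
  | one => simp
  | mul a b _ _ ha hb =>
    rw [map_mul, map_mul, MulAut.mul_apply, mul_assoc, hb, ← mul_assoc, ha, mul_assoc]
  | inv a _ ha =>
    have := ha ((artin n a)⁻¹ x)
    rw [MulAut.apply_inv_self] at this
    rw [map_inv, map_inv, inv_mul_eq_iff_eq_mul, ← mul_assoc, this, mul_inv_cancel_right]

/-! ### The Long-Moody construction -/

/-- The augmentation ideal `I_{F_n}` of the group ring `ℤ[F_n]`. -/
def augIdeal (n : ℕ) : Ideal (MonoidAlgebra ℤ (FreeGroup (Fin n))) :=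
  RingHom.ker (MonoidAlgebra.lift ℤ ℤ (FreeGroup (Fin n)) 1)

/-- An element of the group `F_n` as an element of the group ring. -/
def grp {n : ℕ} (x : FreeGroup (Fin n)) : MonoidAlgebra ℤ (FreeGroup (Fin n)) :=
  MonoidAlgebra.of ℤ (FreeGroup (Fin n)) x

/-- The right multiplication `a ↦ a x` on the augmentation ideal, for `x` in `F_n`. -/
def augMul {n : ℕ} (a : augIdeal n) (x : FreeGroup (Fin n)) : augIdeal n :=
  ⟨a.1 * grp x, by
    have h : MonoidAlgebra.lift ℤ ℤ (FreeGroup (Fin n)) 1 a.1 = 0 := a.2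
    change MonoidAlgebra.lift ℤ ℤ (FreeGroup (Fin n)) 1 (a.1 * grp x) = 0
    rw [map_mul, h, zero_mul]⟩

/-- The action of `wB_n` on the group ring of `F_n` induced by the Artin homomorphism. -/
def ringAct {n : ℕ} (g : WB n) :
    MonoidAlgebra ℤ (FreeGroup (Fin n)) →ₐ[ℤ] MonoidAlgebra ℤ (FreeGroup (Fin n)) :=
  MonoidAlgebra.mapDomainAlgHom ℤ ℤ (artin n g).toMonoidHom

theorem ringAct_grp {n : ℕ} (g : WB n) (x : FreeGroup (Fin n)) :
    ringAct g (grp x) = grp (artin n g x) :=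
  MonoidAlgebra.mapDomain_single

theorem ringAct_one {n : ℕ} : ringAct (1 : WB n) = AlgHom.id ℤ _ := by
  refine MonoidAlgebra.algHom_ext (fun x => ?_) (Subsingleton.elim _ _)
  have := ringAct_grp (1 : WB n) x
  rw [map_one, MulAut.one_apply] at this
  exact this

theorem ringAct_mul {n : ℕ} (g h : WB n) : ringAct (g * h) = (ringAct g).comp (ringAct h) := by
  refine MonoidAlgebra.algHom_ext (fun x => ?_) (Subsingleton.elim _ _)
  have h1 := ringAct_grp (g * h) x
  have h2 : ringAct g (ringAct h (grp x)) = grp (artin n g (artin n h x)) := by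
    rw [ringAct_grp, ringAct_grp]
  rw [map_mul, MulAut.mul_apply, ← h2] at h1
  exact h1

theorem aug_ringAct {n : ℕ} (g : WB n) (a : MonoidAlgebra ℤ (FreeGroup (Fin n))) :
    MonoidAlgebra.lift ℤ ℤ (FreeGroup (Fin n)) 1 (ringAct g a)
      = MonoidAlgebra.lift ℤ ℤ (FreeGroup (Fin n)) 1 a := by
  have : (MonoidAlgebra.lift ℤ ℤ (FreeGroup (Fin n)) 1).comp (ringAct g)
      = MonoidAlgebra.lift ℤ ℤ (FreeGroup (Fin n)) 1 := by
    refine MonoidAlgebra.algHom_ext (fun x => ?_) (Subsingleton.elim _ _)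
    change MonoidAlgebra.lift ℤ ℤ (FreeGroup (Fin n)) 1 (ringAct g (grp x)) = _
    rw [ringAct_grp]
    simp [grp]
  exact DFunLike.congr_fun this a

/-- The action of `wB_n` on the augmentation ideal induced by the Artin homomorphism. -/
def augAct {n : ℕ} (g : WB n) : augIdeal n →ₗ[ℤ] augIdeal n where
  toFun a := ⟨ringAct g a.1, by
    have h : MonoidAlgebra.lift ℤ ℤ (FreeGroup (Fin n)) 1 a.1 = 0 := a.2
    change MonoidAlgebra.lift ℤ ℤ (FreeGroup (Fin n)) 1 (ringAct g a.1) = 0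
    rw [aug_ringAct, h]⟩
  map_add' a b := by ext1; simp
  map_smul' c a := by ext1; simp

theorem augAct_one {n : ℕ} : augAct (1 : WB n) = 1 := by
  apply LinearMap.ext
  intro a
  apply Subtype.ext
  change ringAct (1 : WB n) a.1 = a.1
  rw [ringAct_one]; rfl

theorem augAct_mul {n : ℕ} (g h : WB n) : augAct (g * h) = augAct g * augAct h := by
  apply LinearMap.ext
  intro a
  apply Subtype.ext
  change ringAct (g * h) a.1 = ringAct g (ringAct h a.1)
  rw [ringAct_mul]; rfl

theorem augAct_augMul {n : ℕ} (g : WB n) (a : augIdeal n) (x : FreeGroup (Fin n)) :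
    augAct g (augMul a x) = augMul (augAct g a) (artin n g x) := by
  apply Subtype.ext
  change ringAct g (a.1 * grp x) = ringAct g a.1 * grp (artin n g x)
  rw [map_mul, ringAct_grp]

section LongMoody

variable {n : ℕ} {R V : Type*} [CommRing R] [AddCommGroup V] [Module R V]

/-- The submodule of `V ⊗_ℤ I` of the relations that define the tensor product over `ℤ[F_n]`:
it is spanned by the elements `(x v) ⊗ a - v ⊗ (a x)` for `v` in `V`, `a` in `I` and `x` in `F_n`,
where `F_n` acts on `V` through `ξ`. (As `ℤ[F_n]` is spanned by `F_n`, it is enough to let `x`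
run through the group.) -/
def lmRel (ρ : Representation R (WB (n + 1)) V) : Submodule R (V ⊗[ℤ] augIdeal n) :=
  Submodule.span R {z | ∃ (v : V) (a : augIdeal n) (x : FreeGroup (Fin n)),
    z = ρ (xi n x) v ⊗ₜ[ℤ] a - v ⊗ₜ[ℤ] augMul a x}

/-- The module `I_{F_n} ⊗_{F_n} V`. The factor `V` is written on the left, so that `R` acts on
the tensor product through `V` by Mathlib's instance: the class of `v ⊗ a` here is the element
`a ⊗ v` of `I_{F_n} ⊗_{F_n} V`. -/
abbrev LMSpace (ρ : Representation R (WB (n + 1)) V) : Type _ :=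
  (V ⊗[ℤ] augIdeal n) ⧸ lmRel ρ

/-- The map `v ⊗ a ↦ ρ(id_1 * g)(v) ⊗ g(a)`, before passing to the quotient. -/
def lmPre (ρ : Representation R (WB (n + 1)) V) (g : WB n) :
    V ⊗[ℤ] augIdeal n →ₗ[R] V ⊗[ℤ] augIdeal n :=
  TensorProduct.AlgebraTensorModule.map (ρ (shift n g)) (augAct g)

theorem lmPre_le (ρ : Representation R (WB (n + 1)) V) (g : WB n) :
    lmRel ρ ≤ (lmRel ρ).comap (lmPre ρ g) := by
  rw [lmRel, Submodule.span_le]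
  rintro _ ⟨v, a, x, rfl⟩
  apply Submodule.subset_span
  refine ⟨ρ (shift n g) v, augAct g a, artin n g x, ?_⟩
  have h : ρ (shift n g) (ρ (xi n x) v) = ρ (xi n (artin n g x)) (ρ (shift n g) v) := by
    rw [← Module.End.mul_apply, ← Module.End.mul_apply, ← map_mul, ← map_mul, xi_compat]
  rw [map_sub, ← h, ← augAct_augMul]
  rfl

/-- The Long-Moody construction `LM_1(ρ)`: `g` acts by `a ⊗ v ↦ g(a) ⊗ ρ(id_1 * g)(v)`. -/
def longMoody (ρ : Representation R (WB (n + 1)) V) : Representation R (WB n) (LMSpace ρ) where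
  toFun g := (lmRel ρ).mapQ (lmRel ρ) (lmPre ρ g) (lmPre_le ρ g)
  map_one' := by
    apply Submodule.linearMap_qext
    have h : lmPre ρ 1 = LinearMap.id := by
      rw [lmPre, map_one, map_one, augAct_one]
      exact TensorProduct.AlgebraTensorModule.map_id
    rw [Submodule.mapQ_mkQ, h]
    rfl
  map_mul' g h := by
    apply Submodule.linearMap_qext
    have e : lmPre ρ (g * h) = lmPre ρ g ∘ₗ lmPre ρ h := by
      rw [lmPre, map_mul, map_mul, augAct_mul]
      exact TensorProduct.AlgebraTensorModule.map_comp _ _ _ _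
    rw [Submodule.mapQ_mkQ, e]
    rfl

end LongMoody

/-! ### Short exact sequences of representations -/

/-- There is a short exact sequence `0 → ρ₁ → ρ₂ → ρ₃ → 0` of representations of `G` over `R`. -/
def HasShortExactSequence {G R V₁ V₂ V₃ : Type*} [Group G] [CommRing R]
    [AddCommMonoid V₁] [Module R V₁] [AddCommMonoid V₂] [Module R V₂]
    [AddCommMonoid V₃] [Module R V₃]
    (ρ₁ : Representation R G V₁) (ρ₂ : Representation R G V₂) (ρ₃ : Representation R G V₃) : Prop :=
  ∃ (f : Representation.IntertwiningMap ρ₁ ρ₂) (g : Representation.IntertwiningMap ρ₂ ρ₃),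
    Function.Injective f ∧ Function.Exact f g ∧ Function.Surjective g

/-! ### The coefficients -/

/-- The ring `ℤ[t^{±1}, q^{±1}]` of Laurent polynomials, as Laurent polynomials in `q` over
`ℤ[t^{±1}]`. -/
abbrev Coeff : Type := (ℤ[T;T⁻¹])[T;T⁻¹]

/-- The unit `t`. -/
def tVar : Coeffˣ where
  val := LaurentPolynomial.C (LaurentPolynomial.T 1)
  inv := LaurentPolynomial.C (LaurentPolynomial.T (-1))
  val_inv := by rw [← map_mul, ← LaurentPolynomial.T_add]; simp
  inv_val := by rw [← map_mul, ← LaurentPolynomial.T_add]; simp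

/-- The unit `q`. -/
def qVar : Coeffˣ where
  val := LaurentPolynomial.T 1
  inv := LaurentPolynomial.T (-1)
  val_inv := by rw [← LaurentPolynomial.T_add]; simp
  inv_val := by rw [← LaurentPolynomial.T_add]; simp

end Welded

end

namespace Welded

noncomputable section

/-! ### Representations of the welded braid group on generators -/

/-! Write `ρ` for `q Bur*_{n+1,u}` with `u` any unit; the two sequences are the cases `u = t⁻¹` and
`u = t`.

The augmentation ideal is a free right `ℤ[F_n]`-module on the elements `x_k - 1`, so `LM_1(ρ)` is,
as a module, `n` copies of `R^{n+1}` (`lmEquiv`). Generation comes from the product rule for `xy -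
1`; independence comes from the Fox derivatives, which give a left inverse of `lmSum`
(`lmFox_lmSum`).

The sequence then comes from the line `R e_0` in `R^{n+1}`. Computing `ρ ∘ ξ` explicitly
(`twist_burDual_xi`) shows that each `x_k` preserves this line, acting on it by `q u⁻¹`, and acts on
the quotient `R^n` by the scalar `q`. The image of `id_1 * -` also preserves the line, acting on it
through the one-dimensional representation `q`, and the quotient is `q Bur*_{n,u}`. The outer twist
by `q⁻¹` cancels these factors `q`.

Hence `I ⊗ R e_0` is a subrepresentation and `I ⊗ R^n` the quotient. Since `F_n` acts on each piece
by one scalar `s` common to all `x_k`, the conjugate `x_{i+1}⁻¹ x_i x_{i+1}` contributes `(1 -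
s)(x_{i+1} - 1) + s (x_i - 1)` (`lmMk_augElt_conj`), which is the nontrivial column of the Burau
matrix with parameter `s`. With `s = q u⁻¹` the subrepresentation is `Bur_{n,q/u}`; with `s = q` the
quotient is `Bur*_{n,u} ⊗ Bur_{n,q}`. Equivariance is only checked on generators
(`intertwines_of_generators`). -/

theorem wb_induction {n : ℕ} {P : WB n → Prop} (hs : ∀ i h, P (sigma i h)) (ht : ∀ i h, P (tau i h))
    (h1 : P 1) (hm : ∀ a b, P a → P b → P (a * b)) (hi : ∀ a, P a → P a⁻¹) (g : WB n) : P g := by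
  have hg : g ∈ Subgroup.closure
      (Set.range (PresentedGroup.of (rels := {r : FreeGroup (Gen n) | Rel n r}))) := by
    rw [PresentedGroup.closure_range_of]; trivial
  induction hg using Subgroup.closure_induction with
  | mem g hg =>
    obtain ⟨a, rfl⟩ := hg
    cases a with
    | sigma i h => exact hs i h
    | tau i h => exact ht i h
  | one => exact h1
  | mul a b _ _ ha hb => exact hm a b ha hb
  | inv a _ ha => exact hi a ha

/-- A linear map that commutes with the generators commutes with the group. -/
theorem intertwines_of_generators {n : ℕ} {R V W : Type*} [CommRing R] [AddCommGroup V]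
    [Module R V] [AddCommGroup W] [Module R W] {ρ : Representation R (WB n) V}
    {ρ' : Representation R (WB n) W} (f : V →ₗ[R] W)
    (hs : ∀ i h, f ∘ₗ ρ (sigma i h) = ρ' (sigma i h) ∘ₗ f)
    (ht : ∀ i h, f ∘ₗ ρ (tau i h) = ρ' (tau i h) ∘ₗ f) (g : WB n) :
    f ∘ₗ ρ g = ρ' g ∘ₗ f := by
  induction g using wb_induction with
  | hs i h => exact hs i h
  | ht i h => exact ht i h
  | h1 => rw [map_one, map_one]; rfl
  | hm a b ha hb =>
    rw [map_mul, map_mul, Module.End.mul_eq_comp, Module.End.mul_eq_comp, ← LinearMap.comp_assoc,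
      ha, LinearMap.comp_assoc, hb, LinearMap.comp_assoc]
  | hi a ha =>
    ext v
    -- Evaluating at `ρ a⁻¹ v` turns the relation for `a` into the one for `a⁻¹`.
    have h := LinearMap.congr_fun ha (ρ a⁻¹ v)
    simp only [LinearMap.comp_apply, Representation.self_inv_apply] at h
    simp only [LinearMap.comp_apply, h, Representation.inv_self_apply]

/-! ### Twisted representations on the generators. -/

section Twist

variable {n : ℕ} {R V : Type*} [CommRing R] [AddCommGroup V] [Module R V] (r : Rˣ)
  (ρ : Representation R (WB n) V)

theorem twist_sigma (i : ℕ) (h : i + 1 < n) : twist r ρ (sigma i h) = (r : R) • ρ (sigma i h) := by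
  change (oneDim n r (sigma i h) : R) • ρ (sigma i h) = _
  rw [oneDim, liftWB_sigma]

theorem twist_tau (i : ℕ) (h : i + 1 < n) : twist r ρ (tau i h) = ρ (tau i h) := by
  change (oneDim n r (tau i h) : R) • ρ (tau i h) = _
  rw [oneDim, liftWB_tau, Units.val_one, one_smul]

end Twist

/-! ### The Burau representations in coordinates, and the action of the free group through `ξ`. -/

section Burau

variable {n : ℕ} {R : Type*} [CommRing R]

theorem block_transpose (i : ℕ) (h : i + 1 < n) (a b c d : R) :
    (block i h a b c d)ᵀ = block i h a c b d := by
  ext j k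
  simp only [Matrix.transpose_apply, block, Matrix.of_apply]
  split_ifs <;> simp_all [Pi.single_apply, Fin.ext_iff]; grind

theorem bur_sigma (t : Rˣ) (i : ℕ) (h : i + 1 < n) (v : Fin n → R) (k : Fin n) :
    bur n t (sigma i h) v k =
      if k.1 = i then (t : R) * v ⟨i + 1, h⟩
      else if k.1 = i + 1 then v ⟨i, by omega⟩ + (1 - t) * v ⟨i + 1, h⟩
      else v k := by
  change (burGL n t (sigma i h) : Matrix (Fin n) (Fin n) R).mulVec v k = _
  rw [burGL, liftWB_sigma, burSigma_mulVec]

theorem bur_tau (t : Rˣ) (i : ℕ) (h : i + 1 < n) (v : Fin n → R) (k : Fin n) :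
    bur n t (tau i h) v k =
      if k.1 = i then v ⟨i + 1, h⟩ else if k.1 = i + 1 then v ⟨i, by omega⟩ else v k := by
  change (burGL n t (tau i h) : Matrix (Fin n) (Fin n) R).mulVec v k = _
  rw [burGL, liftWB_tau, burTau_mulVec]

theorem burDual_sigma (t : Rˣ) (i : ℕ) (h : i + 1 < n) (v : Fin n → R) (k : Fin n) :
    burDual n t (sigma i h) v k =
      if k.1 = i then (1 - (↑t⁻¹ : R)) * v ⟨i, by omega⟩ + (↑t⁻¹ : R) * v ⟨i + 1, h⟩
      else if k.1 = i + 1 then v ⟨i, by omega⟩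
      else v k := by
  change ((burGL n t (sigma i h)⁻¹ : Matrix (Fin n) (Fin n) R)ᵀ).mulVec v k = _
  rw [map_inv, burGL, liftWB_sigma]
  change ((block i h _ _ _ _)ᵀ).mulVec v k = _
  rw [block_transpose, block_mulVec]
  simp

theorem burDual_tau (t : Rˣ) (i : ℕ) (h : i + 1 < n) (v : Fin n → R) (k : Fin n) :
    burDual n t (tau i h) v k =
      if k.1 = i then v ⟨i + 1, h⟩ else if k.1 = i + 1 then v ⟨i, by omega⟩ else v k := by
  change ((burGL n t (tau i h)⁻¹ : Matrix (Fin n) (Fin n) R)ᵀ).mulVec v k = _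
  rw [map_inv, burGL, liftWB_tau]
  change ((block i h _ _ _ _)ᵀ).mulVec v k = _
  rw [block_transpose, block_mulVec]
  simp

/-- The chain `τ_{k-1} ⋯ τ_0` moves the entry `0` to the place `k`. -/
theorem twist_burDual_tauChain (q t : Rˣ) (k : ℕ) (hk : k < n) (v : Fin n → R) (j : Fin n) :
    twist q (burDual n t) (tauChain n k hk) v j =
      if j.1 = k then v ⟨0, by omega⟩ else if h : j.1 < k then v ⟨j.1 + 1, by omega⟩ else v j := by
  induction k generalizing j with
  | zero =>
    rw [tauChain, map_one, Module.End.one_apply]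
    split_ifs with h h'
    · exact congrArg v (Fin.ext h)
    · omega
    · rfl
  | succ k ih =>
    -- The new factor `τ_k` stands on the left, so it acts last and exchanges the entries `k` and `k
    -- + 1`. The induction hypothesis is needed at three places: `k + 1`, `k` and `j`.
    rw [tauChain, map_mul, Module.End.mul_apply, twist_tau, burDual_tau, ih, ih, ih]
    obtain ⟨j, hj⟩ := j
    dsimp only
    split_ifs <;> first | rfl | omega | (congr 2; omega)

/-- The action of `x_k` on `q Bur*` through `ξ`: multiplication by `q`, up to the coordinate `0`. -/
theorem twist_burDual_xi (q t : Rˣ) (k : Fin n) (v : Fin (n + 1) → R) (j : Fin (n + 1)) :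
    twist q (burDual (n + 1) t) (xi n (FreeGroup.of k)) v j =
      if j = 0 then q * ((↑t⁻¹ : R) * v 0 + (1 - (↑t⁻¹ : R)) * v k.succ) else q * v j := by
  obtain ⟨k, hk⟩ := k
  rw [xi_of]
  set ρ := twist q (burDual (n + 1) t) with hρ
  have hk' : k < n + 1 := by omega
  set w : Fin (n + 1) → R := fun j =>
    if j = 0 then q * ((↑t⁻¹ : R) * v 0 + (1 - (↑t⁻¹ : R)) * v ⟨k + 1, by omega⟩) else q * v j with hw
  suffices h : ρ (xiVal (n + 1) k (Nat.succ_lt_succ hk)) v = w from congrFun h j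
  -- Applying the chain to both sides removes its inverse from the conjugate `xiVal`. What remains
  -- is `σ_k τ_k` applied to the chain of `v`, whose entries at `k` and `k + 1` are `v_0` and
  -- `v_{k+1}`.
  apply ρ.apply_bijective (tauChain (n + 1) k hk') |>.injective
  rw [← Module.End.mul_apply, ← map_mul, xiVal, mul_assoc, mul_inv_cancel_left, map_mul,
    map_mul, Module.End.mul_apply, Module.End.mul_apply, hρ, twist_sigma, twist_tau,
    LinearMap.smul_apply]
  ext ⟨j, hj⟩
  rw [Pi.smul_apply, smul_eq_mul, burDual_sigma]
  simp only [burDual_tau, twist_burDual_tauChain, hw]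
  -- Only the entry at `k` is changed by more than the factor `q`: on `(v_0, v_{k+1})` the block of
  -- `σ_k τ_k` has first row `(t⁻¹, 1 - t⁻¹)` and second row `(0, 1)`, up to that factor.
  rcases lt_trichotomy j k with h | h | h
  · have h1 : j ≠ k := h.ne
    have h2 : j ≠ k + 1 := by omega
    simp [h, h1, h2]
  · subst h
    simp
    ring
  · by_cases h3 : j = k + 1
    · subst h3
      simp
    · have h1 : j ≠ k := by omega
      have h2 : ¬ j < k := by omega
      have h4 : j ≠ 0 := by omega
      simp [h1, h2, h3, h4, Fin.ext_iff]

end Burau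

/-! ### The Long-Moody module as a direct sum of copies of the module -/

/-- The element `x - 1` of the augmentation ideal. -/
def augElt {n : ℕ} (x : FreeGroup (Fin n)) : augIdeal n :=
  ⟨grp x - 1, by
    change MonoidAlgebra.lift ℤ ℤ (FreeGroup (Fin n)) 1 (grp x - 1) = 0
    simp [grp]⟩

theorem augElt_one {n : ℕ} : augElt (1 : FreeGroup (Fin n)) = 0 := by
  apply Subtype.ext
  change MonoidAlgebra.of ℤ (FreeGroup (Fin n)) 1 - 1 = 0
  rw [map_one, sub_self]

theorem augElt_mul {n : ℕ} (x y : FreeGroup (Fin n)) :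
    augElt (x * y) = augMul (augElt x) y + augElt y := by
  apply Subtype.ext
  change grp (x * y) - 1 = (grp x - 1) * grp y + (grp y - 1)
  simp only [grp, map_mul, sub_mul, one_mul]
  abel

theorem augAct_augElt {n : ℕ} (g : WB n) (x : FreeGroup (Fin n)) :
    augAct g (augElt x) = augElt (artin n g x) := by
  apply Subtype.ext
  change ringAct g (grp x - 1) = grp (artin n g x) - 1
  rw [map_sub, ringAct_grp, map_one]

/-- For every `b` in the group ring, `b` minus its augmentation is an integral combination of
elements `x - 1`: this is linear in `b` and clear for group elements. On the augmentation ideal the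
correction vanishes. -/
theorem augIdeal_eq_span (n : ℕ) (a : augIdeal n) :
    a ∈ Submodule.span ℤ (Set.range (augElt (n := n))) := by
  have key (b : MonoidAlgebra ℤ (FreeGroup (Fin n))) :
      b - algebraMap ℤ _ (MonoidAlgebra.lift ℤ ℤ (FreeGroup (Fin n)) 1 b) ∈
        (Submodule.span ℤ (Set.range (augElt (n := n)))).map
          (Submodule.subtype (augIdeal n)).toAddMonoidHom.toIntLinearMap := by
    induction b using MonoidAlgebra.induction_on with
    | of x =>
      refine ⟨augElt x, Submodule.subset_span ⟨x, rfl⟩, ?_⟩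
      change grp x - 1 = grp x - _
      rw [grp, MonoidAlgebra.lift_of, MonoidHom.one_apply, map_one]
    | add b c hb hc =>
      have := add_mem hb hc
      rw [map_add, map_add]
      convert this using 1
      abel
    | smul r b hb =>
      have := Submodule.smul_mem _ r hb
      rw [map_smul, smul_eq_mul, map_mul, ← Algebra.smul_def, ← smul_sub]
      exact this
  obtain ⟨b, hb, hba⟩ := key a.1
  have h : MonoidAlgebra.lift ℤ ℤ (FreeGroup (Fin n)) 1 a.1 = 0 := a.2
  rw [h, map_zero, sub_zero] at hba
  rwa [← show b = a from Subtype.ext hba]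

section LongMoody

variable {n : ℕ} {R V : Type*} [CommRing R] [AddCommGroup V] [Module R V]
  (ρ : Representation R (WB (n + 1)) V)

/-- The class of `a ⊗ v` in the Long-Moody module. -/
def lmMk (a : augIdeal n) : V →ₗ[R] LMSpace ρ :=
  (lmRel ρ).mkQ ∘ₗ (TensorProduct.AlgebraTensorModule.mk ℤ R V (augIdeal n)).flip a

theorem lmMk_apply (a : augIdeal n) (v : V) : lmMk ρ a v = (lmRel ρ).mkQ (v ⊗ₜ[ℤ] a) := rfl

theorem lmMk_zero (v : V) : lmMk ρ 0 v = 0 := by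
  rw [lmMk_apply, TensorProduct.tmul_zero, map_zero]

theorem lmMk_add (a b : augIdeal n) (v : V) : lmMk ρ (a + b) v = lmMk ρ a v + lmMk ρ b v := by
  simp only [lmMk_apply, TensorProduct.tmul_add, map_add]

theorem lmMk_augMul (a : augIdeal n) (x : FreeGroup (Fin n)) (v : V) :
    lmMk ρ (augMul a x) v = lmMk ρ a (ρ (xi n x) v) := by
  symm
  exact (Submodule.Quotient.eq (lmRel ρ)).2 (Submodule.subset_span ⟨v, a, x, rfl⟩)

theorem longMoody_lmMk (g : WB n) (a : augIdeal n) (v : V) :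
    longMoody ρ g (lmMk ρ a v) = lmMk ρ (augAct g a) (ρ (shift n g) v) := rfl

theorem lmMk_augElt_mul (x y : FreeGroup (Fin n)) (v : V) :
    lmMk ρ (augElt (x * y)) v = lmMk ρ (augElt x) (ρ (xi n y) v) + lmMk ρ (augElt y) v := by
  rw [augElt_mul, lmMk_add, lmMk_augMul]

theorem lmMk_augElt_inv (x : FreeGroup (Fin n)) (v : V) :
    lmMk ρ (augElt x⁻¹) v = -lmMk ρ (augElt x) (ρ (xi n x⁻¹) v) := by
  have h := lmMk_augElt_mul ρ x x⁻¹ v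
  rw [mul_inv_cancel, augElt_one, lmMk_zero] at h
  exact (neg_eq_of_add_eq_zero_right h.symm).symm

/-- This is the identity `x⁻¹yx - 1 = (x - 1)(1 - x⁻¹yx) + (y - 1)x` in the group ring, with the
right factors moved across the tensor sign. It is the source of the nontrivial column of the Burau
matrix of `σ_i`. -/
theorem lmMk_augElt_conj (x y : FreeGroup (Fin n)) (v : V) :
    lmMk ρ (augElt (x⁻¹ * y * x)) v = lmMk ρ (augElt x) (v - ρ (xi n (x⁻¹ * y * x)) v)
      + lmMk ρ (augElt y) (ρ (xi n x) v) := by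
  rw [lmMk_augElt_mul, lmMk_augElt_mul, lmMk_augElt_inv, map_sub]
  simp only [map_mul, Module.End.mul_apply]
  abel

/-- The map `(v_k) ↦ ∑ (x_k - 1) ⊗ v_k`. -/
def lmSum : (Fin n → V) →ₗ[R] LMSpace ρ :=
  LinearMap.lsum R (fun _ => V) R fun k => lmMk ρ (augElt (FreeGroup.of k))

theorem lmSum_single (k : Fin n) (v : V) :
    lmSum ρ (Pi.single k v) = lmMk ρ (augElt (FreeGroup.of k)) v := by
  exact LinearMap.lsum_piSingle R (φ := fun _ => V) R _ k v

/-- Induction on the word `x`: the rules for products and inverses keep the class in the span of the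
`(x_k - 1) ⊗ V`, because `v` is allowed to vary. -/
theorem lmMk_augElt_mem_range (x : FreeGroup (Fin n)) (v : V) :
    lmMk ρ (augElt x) v ∈ LinearMap.range (lmSum ρ) := by
  induction x using FreeGroup.induction_on generalizing v with
  | C1 => rw [augElt_one, lmMk_zero]; exact zero_mem _
  | of k => exact ⟨_, lmSum_single ρ k v⟩
  | inv_of k _ =>
    rw [lmMk_augElt_inv]
    exact neg_mem ⟨_, lmSum_single ρ k _⟩
  | mul x y hx hy =>
    rw [lmMk_augElt_mul]
    exact add_mem (hx _) (hy _)

theorem lmSum_surjective : Function.Surjective (lmSum ρ) := by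
  have key (a : augIdeal n) (v : V) : lmMk ρ a v ∈ LinearMap.range (lmSum ρ) := by
    induction augIdeal_eq_span n a using Submodule.span_induction with
    | mem a ha => obtain ⟨x, rfl⟩ := ha; exact lmMk_augElt_mem_range ρ x v
    | zero => rw [lmMk_zero]; exact zero_mem _
    | add a b _ _ ha hb => rw [lmMk_add]; exact add_mem ha hb
    | smul r a _ ha =>
      have h : lmMk ρ (r • a) v = r • lmMk ρ a v := by
        rw [lmMk_apply, TensorProduct.tmul_smul, map_zsmul, ← lmMk_apply]
      rw [h]
      exact zsmul_mem ha r
  intro z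
  obtain ⟨z, rfl⟩ := (lmRel ρ).mkQ_surjective z
  change (lmRel ρ).mkQ z ∈ LinearMap.range (lmSum ρ)
  induction z with
  | zero => rw [map_zero]; exact zero_mem _
  | tmul v a => exact key a v
  | add y z hy hz => rw [map_add]; exact add_mem hy hz

/-! ### Fox derivatives, and the freeness of the augmentation ideal. -/

/-- The action of the generator `x_k` on `V × V^n` by `(v, w) ↦ (x_k v, w + v e_k)`. -/
def foxGen (k : Fin n) : (V × (Fin n → V)) ≃ₗ[R] (V × (Fin n → V)) :=
  LinearEquiv.ofLinearMap
    (LinearMap.prod (ρ (xi n (FreeGroup.of k)) ∘ₗ LinearMap.fst R V (Fin n → V))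
      (LinearMap.snd R V _ + LinearMap.single R (fun _ => V) k ∘ₗ LinearMap.fst R V _))
    (LinearMap.prod (ρ (xi n (FreeGroup.of k))⁻¹ ∘ₗ LinearMap.fst R V (Fin n → V))
      (LinearMap.snd R V _ - LinearMap.single R (fun _ => V) k ∘ₗ
        ρ (xi n (FreeGroup.of k))⁻¹ ∘ₗ LinearMap.fst R V _))
    (LinearMap.ext fun v => Prod.ext (by simp) (by simp))
    (LinearMap.ext fun v => Prod.ext (by simp) (by simp))

/-- The action of `F_n` on `V × V^n` whose second component is given by the Fox derivatives. -/
def fox : FreeGroup (Fin n) →* Module.End R (V × (Fin n → V)) :=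
  MonoidHom.comp LinearEquiv.automorphismGroup.toLinearMapMonoidHom (FreeGroup.lift (foxGen ρ))

theorem fox_of (k : Fin n) (v : V) (w : Fin n → V) :
    fox ρ (FreeGroup.of k) (v, w) = (ρ (xi n (FreeGroup.of k)) v, w + Pi.single k v) := by
  change FreeGroup.lift (foxGen ρ) (FreeGroup.of k) (v, w) = _
  rw [FreeGroup.lift_apply_of]
  rfl

theorem fox_fst (x : FreeGroup (Fin n)) (p : V × (Fin n → V)) :
    (fox ρ x p).1 = ρ (xi n x) p.1 := by
  induction x using FreeGroup.induction_on generalizing p with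
  | C1 => simp
  | of k => rw [← Prod.mk.eta (p := p), fox_of]
  | inv_of k h =>
    -- The formula for `x_k` at the point `x_k⁻¹ p` expresses `p.1` as `x_k` times the component
    -- wanted.
    have h' := h (fox ρ (FreeGroup.of k)⁻¹ p)
    rw [← Module.End.mul_apply, ← map_mul, mul_inv_cancel, map_one, Module.End.one_apply] at h'
    rw [h', map_inv (xi n), Representation.inv_self_apply]
  | mul x y hx hy => simp only [map_mul, Module.End.mul_apply, hx, hy]

/-- Each generator adds a multiple of the first component only, so `0 × V^n` is fixed pointwise.
Thus `V × V^n` is an extension of `V` by a trivial module. -/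
theorem fox_zero (x : FreeGroup (Fin n)) (w : Fin n → V) : fox ρ x (0, w) = (0, w) := by
  induction x using FreeGroup.induction_on with
  | C1 => simp
  | of k => simp [fox_of]
  | inv_of k h =>
    conv_lhs => rw [← h]
    rw [← Module.End.mul_apply, ← map_mul, inv_mul_cancel, map_one, Module.End.one_apply]
  | mul x y hx hy => rw [map_mul, Module.End.mul_apply, hy, hx]

/-- The extension of `fox` to the group ring. -/
def foxRing : MonoidAlgebra ℤ (FreeGroup (Fin n)) →ₐ[ℤ] Module.End R (V × (Fin n → V)) :=
  MonoidAlgebra.lift ℤ _ _ (fox ρ)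

theorem foxRing_grp (x : FreeGroup (Fin n)) : foxRing ρ (grp x) = fox ρ x :=
  MonoidAlgebra.lift_of _ _

/-- On a trivial module the group ring acts through the augmentation; in particular the augmentation
ideal kills `0 × V^n`. -/
theorem foxRing_zero (a : MonoidAlgebra ℤ (FreeGroup (Fin n))) (w : Fin n → V) :
    foxRing ρ a (0, w) = MonoidAlgebra.lift ℤ ℤ (FreeGroup (Fin n)) 1 a • (0, w) := by
  induction a using MonoidAlgebra.induction_on with
  | of x =>
    rw [MonoidAlgebra.lift_of, MonoidHom.one_apply, one_smul]
    change foxRing ρ (grp x) (0, w) = (0, w)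
    rw [foxRing_grp, fox_zero]
  | add a b ha hb => rw [map_add, map_add, LinearMap.add_apply, ha, hb, add_smul]
  | smul r a ha => rw [map_smul, map_smul, LinearMap.smul_apply, ha, smul_assoc]

/-- This is the balancing relation that lets the Fox derivatives descend to the tensor product over
`ℤ[F_n]`. The element `x` sends `(v, 0)` to `(x v, 0)` plus a vector of `0 × V^n`, and `a` kills the
latter. -/
theorem foxRing_augMul (a : augIdeal n) (x : FreeGroup (Fin n)) (v : V) :
    foxRing ρ (augMul a x).1 (v, 0) = foxRing ρ a.1 (ρ (xi n x) v, 0) := by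
  have h : MonoidAlgebra.lift ℤ ℤ (FreeGroup (Fin n)) 1 a.1 = 0 := a.2
  have e : fox ρ x (v, 0) = (ρ (xi n x) v, 0) + (0, (fox ρ x (v, 0)).2) :=
    Prod.ext (by simp [fox_fst]) (by simp)
  change foxRing ρ (a.1 * grp x) (v, 0) = _
  rw [map_mul, foxRing_grp, Module.End.mul_apply, e, map_add, foxRing_zero, h, zero_smul, add_zero]

/-- The map `a ⊗ v ↦ (∂_k(a) v)_k` given by the Fox derivatives. -/
def lmFox : LMSpace ρ →ₗ[R] (Fin n → V) :=
  (lmRel ρ).liftQ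
    (TensorProduct.AlgebraTensorModule.lift
      { toFun := fun v =>
          { toFun := fun a => (foxRing ρ a.1 (v, 0)).2
            map_add' := fun a b => by simp
            map_smul' := fun r a => by simp }
        map_add' := fun v w => by
          ext1 a
          change (foxRing ρ a.1 (v + w, 0)).2
            = (foxRing ρ a.1 (v, 0)).2 + (foxRing ρ a.1 (w, 0)).2
          rw [← Prod.snd_add, ← map_add, Prod.mk_add_mk, add_zero]
        map_smul' := fun r v => by
          ext1 a
          change (foxRing ρ a.1 (r • v, 0)).2 = r • (foxRing ρ a.1 (v, 0)).2
          rw [← Prod.smul_snd, ← map_smul, Prod.smul_mk, smul_zero] })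
    (by
      rw [lmRel, Submodule.span_le]
      rintro _ ⟨v, a, x, rfl⟩
      rw [SetLike.mem_coe, LinearMap.mem_ker, map_sub, sub_eq_zero]
      exact congrArg Prod.snd (foxRing_augMul ρ a x v).symm)

theorem lmFox_lmMk (k : Fin n) (v : V) :
    lmFox ρ (lmMk ρ (augElt (FreeGroup.of k)) v) = Pi.single k v := by
  change (foxRing ρ (grp (FreeGroup.of k) - 1) (v, 0)).2 = _
  rw [map_sub, foxRing_grp, map_one, LinearMap.sub_apply, fox_of]
  simp

theorem lmFox_lmSum (w : Fin n → V) : lmFox ρ (lmSum ρ w) = w := by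
  have h : lmFox ρ ∘ₗ lmSum ρ = LinearMap.id := by
    apply LinearMap.pi_ext
    intro k v
    rw [LinearMap.comp_apply, lmSum_single, lmFox_lmMk, LinearMap.id_apply]
  exact LinearMap.congr_fun h w

/-- As a module, `LM_1(ρ)` is a direct sum of copies of the space of `ρ`, since the augmentation
ideal is free on the elements `x_k - 1`. -/
def lmEquiv : (Fin n → V) ≃ₗ[R] LMSpace ρ :=
  LinearEquiv.ofBijective (lmSum ρ)
    ⟨Function.LeftInverse.injective (lmFox_lmSum ρ), lmSum_surjective ρ⟩

theorem lmEquiv_single (k : Fin n) (v : V) :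
    lmEquiv ρ (Pi.single k v) = lmMk ρ (augElt (FreeGroup.of k)) v := lmSum_single ρ k v

theorem lmEquiv_symm_lmMk (k : Fin n) (v : V) :
    (lmEquiv ρ).symm (lmMk ρ (augElt (FreeGroup.of k)) v) = Pi.single k v := by
  rw [LinearEquiv.symm_apply_eq, lmEquiv_single]

end LongMoody

/-! ### Linear maps out of the Long-Moody module, and the generators acting on it. -/

section LongMoody

variable {n : ℕ} {R V W : Type*} [CommRing R] [AddCommGroup V] [Module R V]
  [AddCommGroup W] [Module R W] (ρ : Representation R (WB (n + 1)) V)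

/-- The classes `(x_k - 1) ⊗ v` span, by surjectivity of `lmSum`; equivariance of a map out of the
Long-Moody module therefore needs checking on them only. -/
theorem longMoody_hom_ext {f g : LMSpace ρ →ₗ[R] W}
    (h : ∀ k v, f (lmMk ρ (augElt (FreeGroup.of k)) v) = g (lmMk ρ (augElt (FreeGroup.of k)) v)) :
    f = g := by
  rw [← LinearMap.cancel_right (lmSum_surjective ρ)]
  apply LinearMap.pi_ext
  intro k v
  rw [LinearMap.comp_apply, LinearMap.comp_apply, lmSum_single, h]

theorem longMoody_sigma_augElt (i : ℕ) (h : i + 1 < n) (x : FreeGroup (Fin n)) (v : V) :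
    longMoody ρ (sigma i h) (lmMk ρ (augElt x) v)
      = lmMk ρ (augElt (artinSigma i h x)) (ρ (shift n (sigma i h)) v) := by
  rw [longMoody_lmMk, augAct_augElt, artin_sigma]

theorem longMoody_tau_augElt (i : ℕ) (h : i + 1 < n) (x : FreeGroup (Fin n)) (v : V) :
    longMoody ρ (tau i h) (lmMk ρ (augElt x) v)
      = lmMk ρ (augElt (artinTau i h x)) (ρ (shift n (tau i h)) v) := by
  rw [longMoody_lmMk, augAct_augElt, artin_tau]

end LongMoody

/-! ### The Burau representation on basis vectors. -/

section Burau

variable {n : ℕ} {R : Type*} [CommRing R] (t : Rˣ) (i : ℕ) (h : i + 1 < n)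

theorem bur_sigma_single_fst (h' : i < n) :
    bur n t (sigma i h) (Pi.single ⟨i, h'⟩ 1) = Pi.single ⟨i + 1, h⟩ 1 := by
  ext k
  simp only [bur_sigma, Pi.single_apply, Fin.ext_iff]
  grind

theorem bur_sigma_single_snd (h' : i + 1 < n) :
    bur n t (sigma i h) (Pi.single ⟨i + 1, h'⟩ 1) =
      (t : R) • Pi.single ⟨i, by omega⟩ 1 + (1 - (t : R)) • Pi.single ⟨i + 1, h⟩ 1 := by
  ext k
  simp only [bur_sigma, Pi.single_apply, Fin.ext_iff, Pi.add_apply, Pi.smul_apply, smul_eq_mul]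
  grind

theorem bur_sigma_single_other (k : ℕ) (hk : k < n) (h' : k ≠ i ∧ k ≠ i + 1) :
    bur n t (sigma i h) (Pi.single ⟨k, hk⟩ 1) = Pi.single ⟨k, hk⟩ 1 := by
  ext k
  simp only [bur_sigma, Pi.single_apply, Fin.ext_iff]
  grind

theorem bur_tau_single_fst (h' : i < n) :
    bur n t (tau i h) (Pi.single ⟨i, h'⟩ 1) = Pi.single ⟨i + 1, h⟩ 1 := by
  ext k
  simp only [bur_tau, Pi.single_apply, Fin.ext_iff]
  grind

theorem bur_tau_single_snd (h' : i + 1 < n) :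
    bur n t (tau i h) (Pi.single ⟨i + 1, h'⟩ 1) = Pi.single ⟨i, by omega⟩ 1 := by
  ext k
  simp only [bur_tau, Pi.single_apply, Fin.ext_iff]
  grind

theorem bur_tau_single_other (k : ℕ) (hk : k < n) (h' : k ≠ i ∧ k ≠ i + 1) :
    bur n t (tau i h) (Pi.single ⟨k, hk⟩ 1) = Pi.single ⟨k, hk⟩ 1 := by
  ext k
  simp only [bur_tau, Pi.single_apply, Fin.ext_iff]
  grind

end Burau

/-! ### The dual Burau representation as a module over the free group -/

section Sequence

variable (n : ℕ) {R : Type*} [CommRing R] (q u : Rˣ)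

/-- The projection of `R^{n+1}` onto the last `n` coordinates. -/
def tail (n : ℕ) (R : Type*) [CommRing R] : (Fin (n + 1) → R) →ₗ[R] (Fin n → R) :=
  LinearMap.funLeft R R Fin.succ

theorem tail_surjective (R : Type*) [CommRing R] : Function.Surjective (tail n R) :=
  LinearMap.funLeft_surjective_of_injective _ _ _ (Fin.succ_injective n)

theorem tail_eq_zero {n : ℕ} {v : Fin (n + 1) → R} (h : tail n R v = 0) :
    v = v 0 • Pi.single 0 1 := by
  ext j
  refine Fin.cases ?_ (fun j => ?_) j
  · simp
  · simpa [tail, LinearMap.funLeft_apply] using congrFun h j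

theorem tail_single (n : ℕ) : tail n R (Pi.single 0 1) = 0 := by
  ext j
  simp [tail, LinearMap.funLeft_apply]

/-- The representation `q Bur*_{n+1,u}`. -/
abbrev qBurDual : Representation R (WB (n + 1)) (Fin (n + 1) → R) := twist q (burDual (n + 1) u)

variable {n}

/-- After the shift the block sits in rows `i + 1` and `i + 2`, away from coordinate `0`, so only
the twist acts on `e_0`. The outer twist by `q⁻¹` will cancel it. -/
theorem qBurDual_shift_sigma_single (i : ℕ) (h : i + 1 < n) :
    qBurDual n q u (shift n (sigma i h)) (Pi.single 0 1) = (q : R) • Pi.single 0 1 := by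
  ext k
  rw [shift_sigma, twist_sigma, LinearMap.smul_apply, Pi.smul_apply, burDual_sigma]
  simp only [Pi.single_apply, Fin.ext_iff, Pi.smul_apply, smul_eq_mul, Fin.val_zero]
  grind

theorem qBurDual_shift_tau_single (i : ℕ) (h : i + 1 < n) :
    qBurDual n q u (shift n (tau i h)) (Pi.single 0 1) = Pi.single 0 1 := by
  ext k
  rw [shift_tau, twist_tau, burDual_tau]
  simp only [Pi.single_apply, Fin.ext_iff, Fin.val_zero]
  grind

/-- Dropping coordinate `0` undoes the shift of indices, so the quotient by `R e_0` is again a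
twisted dual Burau representation, on one strand fewer. -/
theorem tail_qBurDual_shift_sigma (i : ℕ) (h : i + 1 < n) (v : Fin (n + 1) → R) :
    tail n R (qBurDual n q u (shift n (sigma i h)) v)
      = (q : R) • burDual n u (sigma i h) (tail n R v) := by
  ext k
  rw [shift_sigma, twist_sigma, Pi.smul_apply, burDual_sigma]
  simp [tail, LinearMap.funLeft_apply, burDual_sigma]

theorem tail_qBurDual_shift_tau (i : ℕ) (h : i + 1 < n) (v : Fin (n + 1) → R) :
    tail n R (qBurDual n q u (shift n (tau i h)) v) = burDual n u (tau i h) (tail n R v) := by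
  ext k
  rw [shift_tau, twist_tau, burDual_tau]
  simp [tail, LinearMap.funLeft_apply, burDual_tau]

/-- The scalar does not depend on `k`; it becomes the parameter of the Burau subrepresentation. -/
theorem qBurDual_xi_single (k : Fin n) :
    qBurDual n q u (xi n (FreeGroup.of k)) (Pi.single 0 1)
      = ((q * u⁻¹ : Rˣ) : R) • Pi.single 0 1 := by
  ext j
  rw [twist_burDual_xi]
  refine Fin.cases ?_ (fun j => ?_) j <;> simp

/-- Modulo `R e_0` every `x_k` acts by the same scalar. This makes the quotient of the Long-Moody
module a tensor product, with `q` as the parameter of its Burau factor. -/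
theorem tail_qBurDual_xi (k : Fin n) (v : Fin (n + 1) → R) :
    tail n R (qBurDual n q u (xi n (FreeGroup.of k)) v) = (q : R) • tail n R v := by
  ext j
  simp [tail, LinearMap.funLeft_apply, twist_burDual_xi]

/-- Multiplying a conjugate by `x` on the left removes `x⁻¹`, so its action is found by cancelling
that of `x`, without a formula for the inverse. -/
theorem qBurDual_xi_conj (x y : FreeGroup (Fin n)) (v : Fin (n + 1) → R) :
    qBurDual n q u (xi n x) (qBurDual n q u (xi n (x⁻¹ * y * x)) v)
      = qBurDual n q u (xi n y) (qBurDual n q u (xi n x) v) := by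
  simp only [← Module.End.mul_apply, ← map_mul]
  congr 2
  group

theorem qBurDual_xi_conj_single (j k : Fin n) :
    qBurDual n q u (xi n ((FreeGroup.of j)⁻¹ * FreeGroup.of k * FreeGroup.of j)) (Pi.single 0 1)
      = ((q * u⁻¹ : Rˣ) : R) • Pi.single 0 1 := by
  apply (Representation.apply_bijective (qBurDual n q u) (xi n (FreeGroup.of j))).injective
  rw [qBurDual_xi_conj, map_smul]
  simp only [qBurDual_xi_single, map_smul]

theorem tail_qBurDual_xi_conj (j k : Fin n) (v : Fin (n + 1) → R) :
    tail n R (qBurDual n q u (xi n ((FreeGroup.of j)⁻¹ * FreeGroup.of k * FreeGroup.of j)) v)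
      = (q : R) • tail n R v := by
  have h := congrArg (tail n R) (qBurDual_xi_conj q u (FreeGroup.of j) (FreeGroup.of k) v)
  simp only [tail_qBurDual_xi] at h
  exact q.isUnit.smul_left_cancel.1 h

/-! ### The short exact sequence -/

/-- The map `Bur_{n,q/u} → q⁻¹ LM_1(q Bur*)`, `e_k ↦ (x_k - 1) ⊗ e_0`. -/
def seqInl : (Fin n → R) →ₗ[R] LMSpace (qBurDual n q u) :=
  (lmEquiv (qBurDual n q u)).toLinearMap ∘ₗ
    (LinearMap.toSpanSingleton R _ (Pi.single (0 : Fin (n + 1)) (1 : R))).compLeft (Fin n)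

/-- The map `q⁻¹ LM_1(q Bur*) → Bur* ⊗ Bur_{n,q}`, `(x_k - 1) ⊗ v ↦ tail v ⊗ e_k`. -/
def seqSnd : LMSpace (qBurDual n q u) →ₗ[R] (Fin n → R) ⊗[R] (Fin n → R) :=
  (TensorProduct.piScalarRight R R (Fin n → R) (Fin n)).symm.toLinearMap ∘ₗ
    (tail n R).compLeft (Fin n) ∘ₗ (lmEquiv (qBurDual n q u)).symm.toLinearMap

theorem seqInl_single (k : Fin n) :
    seqInl q u (Pi.single k 1)
      = lmMk (qBurDual n q u) (augElt (FreeGroup.of k)) (Pi.single 0 1) := by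
  rw [← lmEquiv_single]
  refine congrArg (lmEquiv (qBurDual n q u)) (funext fun j => ?_)
  rcases eq_or_ne j k with rfl | h <;> simp_all

theorem seqSnd_lmMk (k : Fin n) (v : Fin (n + 1) → R) :
    seqSnd q u (lmMk (qBurDual n q u) (augElt (FreeGroup.of k)) v)
      = tail n R v ⊗ₜ[R] Pi.single k 1 := by
  rw [← TensorProduct.piScalarRight_symm_single R R]
  simp only [seqSnd, LinearMap.comp_apply, LinearEquiv.coe_coe, lmEquiv_symm_lmMk]
  refine congrArg _ (funext fun j => ?_)
  rcases eq_or_ne j k with rfl | h <;> simp_all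

theorem seqInl_injective : Function.Injective (seqInl (n := n) q u) := by
  refine (lmEquiv (qBurDual n q u)).injective.comp fun v w h => funext fun k => ?_
  -- Entry `0` of the `k`-th copy of `R^{n+1}` recovers the `k`-th coefficient.
  simpa using congrFun (congrFun h k) 0

theorem seqSnd_surjective : Function.Surjective (seqSnd (n := n) q u) :=
  (TensorProduct.piScalarRight R R (Fin n → R) (Fin n)).symm.surjective.comp
    (((tail_surjective n R).comp_left).comp
      (lmEquiv (qBurDual n q u)).symm.surjective)

/-- Through `lmEquiv` the two maps are `n` copies of `R → R^{n+1} → R^n`, the inclusion of `R e_0`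
and the projection along it. -/
theorem seq_exact : Function.Exact (seqInl (n := n) q u) (seqSnd q u) := by
  intro z
  obtain ⟨w, rfl⟩ := (lmEquiv (qBurDual n q u)).surjective z
  simp only [seqSnd, LinearMap.comp_apply, LinearEquiv.coe_coe, LinearEquiv.symm_apply_apply,
    LinearEquiv.map_eq_zero_iff]
  constructor
  · intro h
    exact ⟨fun k => w k 0, congrArg (lmEquiv (qBurDual n q u))
      (funext fun k => (tail_eq_zero (congrFun h k)).symm)⟩
  · rintro ⟨v, hv⟩
    rw [← (lmEquiv (qBurDual n q u)).injective hv]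
    ext1 k
    simp [tail_single]

/-- The factor `q` by which the shifted `σ_i` acts on `e_0` cancels the outer `q⁻¹`, which leaves
the action on the `x_k`. -/
theorem seqInl_sigma (i : ℕ) (h : i + 1 < n) :
    seqInl q u ∘ₗ bur n (q * u⁻¹) (sigma i h)
      = twist q⁻¹ (longMoody (qBurDual n q u)) (sigma i h) ∘ₗ seqInl q u := by
  refine LinearMap.pi_ext' fun ⟨k, hk⟩ => LinearMap.ext_ring ?_
  simp only [LinearMap.comp_apply, LinearMap.single_apply, twist_sigma, LinearMap.smul_apply,
    seqInl_single, longMoody_sigma_augElt, qBurDual_shift_sigma_single]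
  by_cases e0 : k = i
  · subst e0
    rw [artinSigma_fst, bur_sigma_single_fst, seqInl_single, map_smul, smul_smul, Units.inv_mul,
      one_smul]
  by_cases e1 : k = i + 1
  · subst e1
    -- Both the conjugate and `x_{i+1}` act on `e_0` by `s = q u⁻¹`, so the conjugation formula
    -- gives coefficients `1 - s` at `x_{i+1}` and `s` at `x_i`.
    rw [artinSigma_snd, bur_sigma_single_snd, map_smul, smul_smul, Units.inv_mul,
      one_smul, lmMk_augElt_conj, qBurDual_xi_conj_single, qBurDual_xi_single, map_add,
      map_smul, map_smul, map_sub, map_smul, map_smul, seqInl_single, seqInl_single, sub_smul,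
      one_smul]
    abel
  rw [artinSigma_other i h k hk ⟨e0, e1⟩, bur_sigma_single_other _ i h k hk ⟨e0, e1⟩,
    seqInl_single, map_smul, smul_smul, Units.inv_mul, one_smul]

theorem seqInl_tau (i : ℕ) (h : i + 1 < n) :
    seqInl q u ∘ₗ bur n (q * u⁻¹) (tau i h)
      = twist q⁻¹ (longMoody (qBurDual n q u)) (tau i h) ∘ₗ seqInl q u := by
  refine LinearMap.pi_ext' fun ⟨k, hk⟩ => LinearMap.ext_ring ?_
  simp only [LinearMap.comp_apply, LinearMap.single_apply, twist_tau,
    seqInl_single, longMoody_tau_augElt, qBurDual_shift_tau_single]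
  by_cases e0 : k = i
  · subst e0
    rw [artinTau_fst, bur_tau_single_fst, seqInl_single]
  by_cases e1 : k = i + 1
  · subst e1
    rw [artinTau_snd, bur_tau_single_snd, seqInl_single]
  rw [artinTau_other i h k hk ⟨e0, e1⟩, bur_tau_single_other _ i h k hk ⟨e0, e1⟩, seqInl_single]

theorem seqSnd_sigma (i : ℕ) (h : i + 1 < n) :
    seqSnd q u ∘ₗ twist q⁻¹ (longMoody (qBurDual n q u)) (sigma i h)
      = (burDual n u).tprod (bur n q) (sigma i h) ∘ₗ seqSnd q u := by
  refine longMoody_hom_ext _ fun ⟨k, hk⟩ v => ?_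
  simp only [LinearMap.comp_apply, twist_sigma, LinearMap.smul_apply, map_smul,
    longMoody_sigma_augElt, seqSnd_lmMk, Representation.tprod_apply, TensorProduct.map_tmul]
  by_cases e0 : k = i
  · subst e0
    rw [artinSigma_fst, bur_sigma_single_fst, seqSnd_lmMk, tail_qBurDual_shift_sigma,
      TensorProduct.smul_tmul', smul_smul, Units.inv_mul, one_smul]
  by_cases e1 : k = i + 1
  · subst e1
    -- The same formula with the scalar `q`: after projection the coefficients are `1 - q` at
    -- `e_{i+1}` and `q` at `e_i`. The remaining factor `q`, from the shifted `σ_i`, cancels the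
    -- outer `q⁻¹`.
    rw [artinSigma_snd, bur_sigma_single_snd, sub_smul, one_smul, lmMk_augElt_conj, map_add, seqSnd_lmMk,
      seqSnd_lmMk, map_sub, tail_qBurDual_xi_conj, tail_qBurDual_xi, tail_qBurDual_shift_sigma,
      TensorProduct.sub_tmul, TensorProduct.tmul_add, TensorProduct.tmul_sub,
      TensorProduct.tmul_smul, TensorProduct.tmul_smul]
    simp only [← TensorProduct.smul_tmul', smul_add, smul_sub, smul_smul, Units.inv_mul_cancel_left,
      Units.inv_mul, one_smul]
    rw [add_comm]
  rw [artinSigma_other i h k hk ⟨e0, e1⟩, bur_sigma_single_other _ i h k hk ⟨e0, e1⟩,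
    seqSnd_lmMk, tail_qBurDual_shift_sigma, TensorProduct.smul_tmul', smul_smul, Units.inv_mul,
    one_smul]

theorem seqSnd_tau (i : ℕ) (h : i + 1 < n) :
    seqSnd q u ∘ₗ twist q⁻¹ (longMoody (qBurDual n q u)) (tau i h)
      = (burDual n u).tprod (bur n q) (tau i h) ∘ₗ seqSnd q u := by
  refine longMoody_hom_ext _ fun ⟨k, hk⟩ v => ?_
  simp only [LinearMap.comp_apply, twist_tau,
    longMoody_tau_augElt, seqSnd_lmMk, Representation.tprod_apply, TensorProduct.map_tmul]
  by_cases e0 : k = i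
  · subst e0
    rw [artinTau_fst, bur_tau_single_fst, seqSnd_lmMk, tail_qBurDual_shift_tau]
  by_cases e1 : k = i + 1
  · subst e1
    rw [artinTau_snd, bur_tau_single_snd, seqSnd_lmMk, tail_qBurDual_shift_tau]
  rw [artinTau_other i h k hk ⟨e0, e1⟩, bur_tau_single_other _ i h k hk ⟨e0, e1⟩,
    seqSnd_lmMk, tail_qBurDual_shift_tau]

/-- The short exact sequence over any commutative ring. -/
theorem hasShortExactSequence_longMoody_burDual (n : ℕ) (q u : Rˣ) :
    HasShortExactSequence (bur n (q * u⁻¹))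
      (twist q⁻¹ (longMoody (twist q (burDual (n + 1) u)))) ((burDual n u).tprod (bur n q)) :=
  ⟨⟨seqInl q u, intertwines_of_generators _ (seqInl_sigma q u) (seqInl_tau q u)⟩,
    ⟨seqSnd q u, intertwines_of_generators _ (seqSnd_sigma q u) (seqSnd_tau q u)⟩,
    seqInl_injective q u, seq_exact q u, seqSnd_surjective q u⟩

end Sequence

end

end Welded

open Welded in
theorem mainTheorem1 (n : ℕ) (hn : 3 ≤ n) :
    HasShortExactSequence (bur n (qVar * tVar))
      (twist qVar⁻¹ (longMoody (twist qVar (burDual (n + 1) tVar⁻¹))))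
      ((burDual n tVar⁻¹).tprod (bur n qVar)) ∧
    HasShortExactSequence (bur n (qVar * tVar⁻¹))
      (twist qVar⁻¹ (longMoody (twist qVar (burDual (n + 1) tVar))))
      ((burDual n tVar).tprod (bur n qVar)) := by
  refine ⟨?_, hasShortExactSequence_longMoody_burDual n qVar tVar⟩
  -- With `u = t⁻¹` the parameter `q u⁻¹` is `q (t⁻¹)⁻¹ = q t`.
  have h := hasShortExactSequence_longMoody_burDual n qVar tVar⁻¹
  rwa [inv_inv] at h
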